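/- **τ-risk sensitive filter.** Let $x_{t+1}=A_tx_t+B_tv_t$, $y_t=C_tx_t+D_tv_t$ ($t\ge 0$, $x_t\in\mathbb R^n$, $y_t\in\mathbb R^p$) be a nominal model, where $v_t$ is white Gaussian noise with unit covariance, independent of $x_0\sim\mathcal N(\hat x_0,V_0)$, $V_0$ is symmetric positive semidefinite, and $\Gamma_t\Gamma_t^T>0$ with $\Gamma_t=\begin{bmatrix}B_t\\D_t\end{bmatrix}$. Fix $0\le\tau\le 1$ and a constant $\theta>0$. *τ-divergence.* For Gaussian densities $f=\mathcal N(m,K)$, $\tilde f=\mathcal N(\tilde m,\tilde K)$ with $K,\tilde K>0$, $K=LL^T$ ($L$ square), put $S=L^{-1}\tilde KL^{-T}$, $\Delta=\tilde m-m$, $\|v\|_W^2=v^TWv$, and $$\mathcal D_\tau(\tilde f\|f)=\begin{cases}\|\Delta\|^2_{K^{-1}}+\operatorname{tr}(-\log S+\tilde KK^{-1}-I), & \tau=0,\\ \|\Delta\|^2_{\frac1{1-\tau}K^{-1}}+\operatorname{tr}\big(-\tfrac1{\tau(1-\tau)}S^\tau+\tfrac1{1-\tau}\tilde KK^{-1}+\tfrac1\tau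 I\big), & 0<\tau<1,\\ \delta_\infty(\Delta)+\operatorname{tr}(S\log S-\tilde KK^{-1}+I), & \tau=1,\end{cases}$$ where $\delta_\infty(0)=0$ and $\delta_\infty(v)=\infty$ for $v\ne0$. *τ-distortion.* For $P=L_PL_P^T$ with $L_P\in\mathbb R^{n\times n}$, $$\mathcal V_\tau(P)=\begin{cases}L_P\big(I-\theta(1-\tau)L_P^TL_P\big)^{\frac1{\tau-1}}L_P^T, & 0\le\tau<1,\\ L_P\exp(\theta L_P^TL_P)L_P^T, & \tau=1.\end{cases}$$ *Filter.* Starting from $\hat x_0,V_0$, given the observations $y_0,y_1,\dots$, $$\hat x_{t+1}=A_t\hat x_t+G_t(y_t-C_t\hat x_t),\qquad G_t=(A_tV_tC_t^T+B_tD_t^T)(C_tV_tC_t^T+D_tD_t^T)^{-1},$$ $$P_{t+1}=A_tV_tA_t^T-G_t(C_tV_tC_t^T+D_tD_t^T)G_t^T+B_tB_t^T,\qquad V_{t+1}=\mathcal V_\tau(P_{t+1}).$$ Then: 1. (Well-definedness.) If $0<P<(\theta(1-\tau))^{-1}I$ and $\tau<1$, or $P>0$ and $\tau=1$, then a factor $L_P$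 exists, for $\tau<1$ the matrix $I-\theta(1-\tau)L_P^TL_P$ is positive definite for every such factor, $\mathcal V_\tau(P)$ does not depend on the choice of $L_P$, and $\mathcal V_\tau(P)>0$. 2. (Optimality.) Let $t\ge0$ and, if $\tau<1$, suppose $P_{s+1}<(\theta(1-\tau))^{-1}I$ for all $0\le s\le t$ (no condition if $\tau=1$). Then $P_{t+1}>0$ and $V_{t+1}>0$. If $x_t\sim\mathcal N(\hat x_t,V_t)$ is independent of $v_t\sim\mathcal N(0,I)$, then $z_t=[x_{t+1}^T\;y_t^T]^T$ has under the nominal model the law $\bar f_t=\mathcal N(\bar m_t,K_{z_t})$, where $$\bar m_t=\begin{bmatrix}A_t\\C_t\end{bmatrix}\hat x_t,\qquad K_{z_t}=\begin{bmatrix}K_x&K_{xy}\\K_{yx}&K_y\end{bmatrix}=\begin{bmatrix}A_t\\C_t\end{bmatrix}V_t\begin{bmatrix}A_t^T&C_t^T\end{bmatrix}+\Gamma_t\Gamma_t^T>0,$$ and $P_{t+1}=K_x-K_{xy}K_y^{-1}K_{yx}$. Consider the penalized minimax problem $$\min_{g\in\mathcal G_t}\ \max_{\tilde f\in\mathcal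 B_t}\ \mathbb E_{\tilde f}\big[\|x_{t+1}-g(y_t)\|^2\big]-\theta^{-1}\mathcal D_\tau(\tilde f\|\bar f_t),$$ where $\mathcal B_t$ is the set of nondegenerate Gaussian densities $\tilde f$ of $z_t$ with $\mathcal D_\tau(\tilde f\|\bar f_t)<\infty$ and $\mathcal G_t$ is the set of measurable $g:\mathbb R^p\to\mathbb R^n$ with $\mathbb E_{\tilde f}\|g(y_t)\|^2<\infty$ for all $\tilde f\in\mathcal B_t$. A solution is a pair $(\tilde f,g)$ such that $g$ minimizes over $\mathcal G_t$ the supremum over $\mathcal B_t$ of the objective, and $\tilde f$ attains this supremum for $g$. The pair $(\tilde f_t^\circ,g_t^\circ)$ with $$g_t^\circ(y)=A_t\hat x_t+G_t(y-C_t\hat x_t),\qquad \tilde f_t^\circ=\mathcal N\left(\bar m_t,\begin{bmatrix}V_{t+1}+K_{xy}K_y^{-1}K_{yx}&K_{xy}\\K_{yx}&K_y\end{bmatrix}\right)$$ is a solution, and it is the only one, $g_t^\circ$ being unique up to equality Lebesgue-almost everywhere. In particular $\hat x_{t+1}=g_t^\circ(y_t)$, and $V_{t+1}$ is the covariance of $x_{t+1}$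 given $y_t$ under $\tilde f_t^\circ$. -/

import Mathlib

open MeasureTheory ProbabilityTheory Matrix

noncomputable section

namespace TauRS

/-- `ℝᵏ` (indexed by `ι`) with the Euclidean norm. -/
abbrev E (ι : Type) [Fintype ι] : Type := EuclideanSpace ℝ ι

/-- The block `x` of the vector `z = [xᵀ yᵀ]ᵀ`. -/
def xPart {n p : ℕ} (z : E (Fin n ⊕ Fin p)) : E (Fin n) :=
  WithLp.toLp 2 (fun i => z (Sum.inl i))

/-- The block `y` of the vector `z = [xᵀ yᵀ]ᵀ`. -/
def yPart {n p : ℕ} (z : E (Fin n ⊕ Fin p)) : E (Fin p) :=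
  WithLp.toLp 2 (fun j => z (Sum.inr j))

/-- The vector `z = [xᵀ yᵀ]ᵀ`. -/
def stack {n p : ℕ} (x : E (Fin n)) (y : E (Fin p)) : E (Fin n ⊕ Fin p) :=
  WithLp.toLp 2 (Sum.elim x y)

/-! ### The tau-divergence between Gaussian densities -/

section Divergence

variable {ι : Type} [Fintype ι] [DecidableEq ι]

/-- `δ_∞(v)`: zero at `v = 0`, infinite elsewhere. -/
def deltaInfty (v : E ι) : EReal :=
  open Classical in if v = 0 then 0 else ⊤

/-- The normalized covariance `L⁻¹ K' L⁻ᵀ`. -/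
def normalizedCov (L K' : Matrix ι ι ℝ) : Matrix ι ι ℝ := L⁻¹ * K' * L⁻¹ᵀ

/-- The weighted square norm `‖v‖²_W = vᵀ W v`. -/
def weightedSq (W : Matrix ι ι ℝ) (v : E ι) : ℝ := v.ofLp ⬝ᵥ (W *ᵥ v.ofLp)

/-- The tau-divergence `D_τ(N(m', K') ‖ N(m, K))`, where `K = L Lᵀ`, for `0 ≤ τ ≤ 1`.
Matrix powers and logarithms are those of the symmetric functional calculus, applied to
`S = L⁻¹ K' L⁻ᵀ`. For `τ = 0`, `tr log (K' K⁻¹)` is read as `tr log S`: the two matrices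
are similar. -/
def tauDiv (τ : ℝ) (m : E ι) (L : Matrix ι ι ℝ) (m' : E ι) (K' : Matrix ι ι ℝ) : EReal :=
  let K := L * Lᵀ
  let S := normalizedCov L K'
  if τ = 0 then
    ((weightedSq K⁻¹ (m' - m) + trace (-(cfc Real.log S) + K' * K⁻¹ - 1) : ℝ) : EReal)
  else if τ = 1 then
    deltaInfty (m' - m) + ((trace (S * cfc Real.log S - K' * K⁻¹ + 1) : ℝ) : EReal)
  else
    ((weightedSq ((1 / (1 - τ)) • K⁻¹) (m' - m) +
      trace (-((1 / (τ * (1 - τ))) • cfc (fun s : ℝ => s ^ τ) S)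
        + (1 / (1 - τ)) • (K' * K⁻¹) + (1 / τ) • (1 : Matrix ι ι ℝ)) : ℝ) : EReal)

end Divergence

/-! ### The penalized minimax problem -/

section Minimax

variable {n p : ℕ}

/-- Mean and covariance, the parameters of a Gaussian density of `z = [xᵀ yᵀ]ᵀ`. -/
abbrev GaussParam (n p : ℕ) : Type :=
  E (Fin n ⊕ Fin p) × Matrix (Fin n ⊕ Fin p) (Fin n ⊕ Fin p) ℝ

/-- The Gaussian law with the given mean and covariance. -/
abbrev GaussParam.law (f : GaussParam n p) : Measure (E (Fin n ⊕ Fin p)) :=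
  multivariateGaussian f.1 f.2

/-- The nondegenerate Gaussian densities at finite tau-divergence from the nominal density
`N(m, L Lᵀ)`. -/
def finiteDivSet (τ : ℝ) (m : E (Fin n ⊕ Fin p))
    (L : Matrix (Fin n ⊕ Fin p) (Fin n ⊕ Fin p) ℝ) : Set (GaussParam n p) :=
  {f | f.2.PosDef ∧ tauDiv τ m L f.1 f.2 < ⊤}

/-- The estimators `g` of `x` given `y` such that `𝔼[‖g(y)‖²]` is finite under all densities at
finite tau-divergence from the nominal one. -/
def estimators (τ : ℝ) (m : E (Fin n ⊕ Fin p))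
    (L : Matrix (Fin n ⊕ Fin p) (Fin n ⊕ Fin p) ℝ) : Set (E (Fin p) → E (Fin n)) :=
  {g | Measurable g ∧ ∀ f ∈ finiteDivSet τ m L, MemLp (fun z => g (yPart z)) 2 f.law}

/-- The penalized mean square error `𝔼_f[‖x - g(y)‖²] - θ⁻¹ D_τ(f ‖ nominal)`. It is only used
for `f` at finite divergence. -/
def penalizedMSE (τ θ : ℝ) (m : E (Fin n ⊕ Fin p))
    (L : Matrix (Fin n ⊕ Fin p) (Fin n ⊕ Fin p) ℝ) (f : GaussParam n p)
    (g : E (Fin p) → E (Fin n)) : ℝ :=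
  ∫ z, ‖xPart z - g (yPart z)‖ ^ 2 ∂f.law - θ⁻¹ * (tauDiv τ m L f.1 f.2).toReal

/-- The worst case of the penalized mean square error of `g`. -/
def worstCase (τ θ : ℝ) (m : E (Fin n ⊕ Fin p))
    (L : Matrix (Fin n ⊕ Fin p) (Fin n ⊕ Fin p) ℝ) (g : E (Fin p) → E (Fin n)) : EReal :=
  ⨆ f ∈ finiteDivSet τ m L, ((penalizedMSE τ θ m L f g : ℝ) : EReal)

/-- `(f, g)` solves `min_g max_f 𝔼_f[‖x - g(y)‖²] - θ⁻¹ D_τ(f ‖ nominal)`: the estimator `g`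
minimizes the worst case, and `f` attains the maximum for `g`. -/
structure IsMinimaxSolution (τ θ : ℝ) (m : E (Fin n ⊕ Fin p))
    (L : Matrix (Fin n ⊕ Fin p) (Fin n ⊕ Fin p) ℝ) (f : GaussParam n p)
    (g : E (Fin p) → E (Fin n)) : Prop where
  mem_estimators : g ∈ estimators τ m L
  mem_finiteDivSet : f ∈ finiteDivSet τ m L
  isMax : ∀ f' ∈ finiteDivSet τ m L, penalizedMSE τ θ m L f' g ≤ penalizedMSE τ θ m L f g
  isMin : ∀ g' ∈ estimators τ m L, worstCase τ θ m L g ≤ worstCase τ θ m L g'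

end Minimax

/-! ### The tau-distortion -/

section Distortion

variable {n : ℕ}

/-- The tau-distortion written with a factor `L` of `P = L Lᵀ`:
`L (I - θ(1-τ) LᵀL)^{1/(τ-1)} Lᵀ` for `0 ≤ τ < 1` and `L exp(θ LᵀL) Lᵀ` for `τ = 1`. -/
def distortFactor (τ θ : ℝ) (L : Matrix (Fin n) (Fin n) ℝ) : Matrix (Fin n) (Fin n) ℝ :=
  if τ < 1 then
    L * cfc (fun s : ℝ => s ^ (1 / (τ - 1))) (1 - (θ * (1 - τ)) • (Lᵀ * L)) * Lᵀ
  else L * NormedSpace.exp (θ • (Lᵀ * L)) * Lᵀ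

/-- The tau-distortion of `P`, computed with the symmetric square root of `P` as factor. -/
def distort (τ θ : ℝ) (P : Matrix (Fin n) (Fin n) ℝ) : Matrix (Fin n) (Fin n) ℝ :=
  distortFactor τ θ (cfc Real.sqrt P)

/-- `P < (θ(1-τ))⁻¹ I` if `τ < 1`; no condition if `τ = 1`. -/
def BelowThreshold (τ θ : ℝ) (P : Matrix (Fin n) (Fin n) ℝ) : Prop :=
  τ < 1 → ((θ * (1 - τ))⁻¹ • (1 : Matrix (Fin n) (Fin n) ℝ) - P).PosDef

end Distortion

/-! ### The state space model and the filter -/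

/-- The data of the nominal model `x_{t+1} = A_t x_t + B_t v_t`, `y_t = C_t x_t + D_t v_t`, with
initial law `N(x0, V0)` and standard white Gaussian noise `v`. -/
structure StateSpaceModel (n p m : ℕ) where
  A : ℕ → Matrix (Fin n) (Fin n) ℝ
  B : ℕ → Matrix (Fin n) (Fin m) ℝ
  C : ℕ → Matrix (Fin p) (Fin n) ℝ
  D : ℕ → Matrix (Fin p) (Fin m) ℝ
  x0 : E (Fin n)
  V0 : Matrix (Fin n) (Fin n) ℝ

namespace StateSpaceModel

variable {n p m : ℕ} (M : StateSpaceModel n p m)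

/-- The gain `G_t` obtained from `V = V_t`. -/
def gainOf (t : ℕ) (V : Matrix (Fin n) (Fin n) ℝ) : Matrix (Fin n) (Fin p) ℝ :=
  (M.A t * V * (M.C t)ᵀ + M.B t * (M.D t)ᵀ) * (M.C t * V * (M.C t)ᵀ + M.D t * (M.D t)ᵀ)⁻¹

/-- The matrix `P_{t+1}` obtained from `V = V_t`. -/
def riccati (t : ℕ) (V : Matrix (Fin n) (Fin n) ℝ) : Matrix (Fin n) (Fin n) ℝ :=
  M.A t * V * (M.A t)ᵀ
    - M.gainOf t V * (M.C t * V * (M.C t)ᵀ + M.D t * (M.D t)ᵀ) * (M.gainOf t V)ᵀ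
    + M.B t * (M.B t)ᵀ

/-- The matrices `V_t` of the tau-risk sensitive filter with constant parameter `θ`. -/
def V (τ θ : ℝ) : ℕ → Matrix (Fin n) (Fin n) ℝ
  | 0 => M.V0
  | t + 1 => distort τ θ (M.riccati t (V τ θ t))

/-- The gain `G_t` of the filter. -/
def gain (τ θ : ℝ) (t : ℕ) : Matrix (Fin n) (Fin p) ℝ := M.gainOf t (M.V τ θ t)

/-- The matrix `P_{t+1}` of the filter. -/
def nextP (τ θ : ℝ) (t : ℕ) : Matrix (Fin n) (Fin n) ℝ := M.riccati t (M.V τ θ t)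

/-- One step of the filter: `x̂ ↦ A_t x̂ + G_t (y - C_t x̂)`, as a function of `y`. -/
def update (τ θ : ℝ) (t : ℕ) (xhat : E (Fin n)) (y : E (Fin p)) : E (Fin n) :=
  toEuclideanLin (M.A t) xhat
    + toEuclideanLin (M.gain τ θ t) (y - toEuclideanLin (M.C t) xhat)

/-- The estimates `x̂_t` produced by the filter from the observations `y_0, y_1, …`. -/
def xhat (τ θ : ℝ) (y : ℕ → E (Fin p)) : ℕ → E (Fin n)
  | 0 => M.x0
  | t + 1 => M.update τ θ t (xhat τ θ y t) (y t)

/-- The noise matrix `Γ_t = [B_tᵀ D_tᵀ]ᵀ`. -/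
def noise (t : ℕ) : Matrix (Fin n ⊕ Fin p) (Fin m) ℝ := fromRows (M.B t) (M.D t)

/-- The mean `[A_t; C_t] x̂_t` of the pseudo-nominal density of `z_t = [x_{t+1}ᵀ y_tᵀ]ᵀ`. -/
def nominalMean (t : ℕ) (xhat : E (Fin n)) : E (Fin n ⊕ Fin p) :=
  stack (toEuclideanLin (M.A t) xhat) (toEuclideanLin (M.C t) xhat)

/-- The covariance `K_{z_t}` of the pseudo-nominal density of `z_t`. -/
def nominalCov (τ θ : ℝ) (t : ℕ) : Matrix (Fin n ⊕ Fin p) (Fin n ⊕ Fin p) ℝ :=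
  fromRows (M.A t) (M.C t) * M.V τ θ t * (fromRows (M.A t) (M.C t))ᵀ
    + M.noise t * (M.noise t)ᵀ

/-- The law of `z_t = [x_{t+1}ᵀ y_tᵀ]ᵀ` under the nominal model at time `t`, when `x_t` has law
`N(x̂, V_t)` and is independent of the standard Gaussian `v_t`. -/
def pseudoNominalLaw (τ θ : ℝ) (t : ℕ) (xhat : E (Fin n)) : Measure (E (Fin n ⊕ Fin p)) :=
  ((multivariateGaussian xhat (M.V τ θ t)).prod (stdGaussian (E (Fin m)))).map
    (fun w => stack (toEuclideanLin (M.A t) w.1 + toEuclideanLin (M.B t) w.2)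
      (toEuclideanLin (M.C t) w.1 + toEuclideanLin (M.D t) w.2))

/-- The covariance which agrees with `K_{z_t}` except in its `x`-block, chosen so that the
conditional covariance of `x_{t+1}` given `y_t` is `V_{t+1}`. -/
def leastFavorableCov (τ θ : ℝ) (t : ℕ) : Matrix (Fin n ⊕ Fin p) (Fin n ⊕ Fin p) ℝ :=
  let K := M.nominalCov τ θ t
  fromBlocks (M.V τ θ (t + 1) + K.toBlocks₁₂ * K.toBlocks₂₂⁻¹ * K.toBlocks₂₁)
    K.toBlocks₁₂ K.toBlocks₂₁ K.toBlocks₂₂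

end StateSpaceModel

end TauRS

end

open TauRS

noncomputable section

namespace TauRS

/-! ### Functional calculus of real symmetric matrices -/

section FunctionalCalculus

/-! The solution is a saddle point. Write `K = L Lᵀ` for the nominal covariance, `G` for the gain
`K_{xy} K_y⁻¹`, `M = [I, -G]` and `N = M L`, so that `N Nᵀ` is the Schur complement `P` of `K_y`.

For the affine estimator with gain `G`, the penalized error at a Gaussian with mean `m + v` and
normalized covariance `S` splits into `‖M v‖² - θ⁻¹ meanDiv v` and `tr(NᵀN S) - θ⁻¹ tr h(S)`, where
`h = divFun τ`. The threshold makes the first term negative unless `v = 0`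
(`dotProduct_mulVec_le_meanDiv`). For the second, `h` is strictly convex on the positive axis and
`h'(S₀) = θ NᵀN` at `S₀ = distortFun(NᵀN)`; `klein_inequality` then makes `S₀` the only maximizer
(`penalizedTrace_le`).

Since `distortFun` is `1` at `0`, `S₀ = I + Nᵀ r(P) N` with `r(x) = (distortFun x - 1)/x`. As `L Nᵀ
= K Mᵀ = [P; 0]`, the covariance `L S₀ Lᵀ` differs from `K` only in the `x`-block, where `P` becomes
its distortion (`mul_cfc_mul_transpose_eq_distortedCov`). The gain is therefore unchanged, and the
affine estimator is also the best one under the distorted law (`integral_norm_sq_sub`). This gives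
the saddle inequalities.

For uniqueness, another optimal estimator has zero excess error under the distorted law, hence
agrees with the affine one almost everywhere; strictness in the first half then determines the
density. -/

lemma isSelfAdjoint_transpose_mul_self {ι κ : Type*} [Fintype κ] (N : Matrix κ ι ℝ) :
    IsSelfAdjoint (Nᵀ * N) :=
  isHermitian_conjTranspose_mul_self N

lemma isSelfAdjoint_mul_transpose_self {ι κ : Type*} [Fintype ι] (N : Matrix κ ι ℝ) :
    IsSelfAdjoint (N * Nᵀ) :=
  isHermitian_mul_conjTranspose_self N

variable {ι κ : Type*} [Fintype ι] [DecidableEq ι] [Fintype κ] [DecidableEq κ]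

/-- A matrix has finite spectrum, so every function is continuous on it. Logarithms, real powers and
quotients by `x` can thus enter the functional calculus without side conditions. -/
lemma continuousOn_spectrum (f : ℝ → ℝ) (A : Matrix ι ι ℝ) : ContinuousOn f (spectrum ℝ A) :=
  Matrix.finite_real_spectrum.continuousOn f

lemma continuousOn_image_spectrum (g f : ℝ → ℝ) (A : Matrix ι ι ℝ) :
    ContinuousOn g (f '' spectrum ℝ A) :=
  (Matrix.finite_real_spectrum.image f).continuousOn g

lemma cfc_transpose (f : ℝ → ℝ) (A : Matrix ι ι ℝ) : (cfc f A)ᵀ = cfc f A :=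
  (cfc_predicate f A : IsSelfAdjoint (cfc f A))

/-- Lagrange interpolation on the union of the two finite spectra. A single polynomial for both
matrices is what allows functions to be moved across an intertwiner. -/
lemma exists_polynomial_cfc (f : ℝ → ℝ) {A : Matrix ι ι ℝ} {B : Matrix κ κ ℝ}
    (hA : IsSelfAdjoint A) (hB : IsSelfAdjoint B) :
    ∃ q : Polynomial ℝ, cfc f A = Polynomial.aeval A q ∧ cfc f B = Polynomial.aeval B q := by
  have hfin : (spectrum ℝ A ∪ spectrum ℝ B).Finite :=
    Matrix.finite_real_spectrum.union Matrix.finite_real_spectrum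
  set q := Lagrange.interpolate hfin.toFinset id f
  have hq : ∀ x ∈ spectrum ℝ A ∪ spectrum ℝ B, f x = q.eval x := fun x hx =>
    (Lagrange.eval_interpolate_at_node (v := id) f Function.injective_id.injOn
      (hfin.mem_toFinset.2 hx)).symm
  refine ⟨q, ?_, ?_⟩
  · rw [← cfc_polynomial q A hA]
    exact cfc_congr fun x hx => hq x (Or.inl hx)
  · rw [← cfc_polynomial q B hB]
    exact cfc_congr fun x hx => hq x (Or.inr hx)

lemma aeval_mul_of_intertwine {A : Matrix ι ι ℝ} {B : Matrix κ κ ℝ} {T : Matrix ι κ ℝ}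
    (h : A * T = T * B) (q : Polynomial ℝ) :
    Polynomial.aeval A q * T = T * Polynomial.aeval B q := by
  induction q using Polynomial.induction_on' with
  | add p q hp hq => simp only [map_add, Matrix.add_mul, Matrix.mul_add, hp, hq]
  | monomial k a =>
    have hk : A ^ k * T = T * B ^ k := by
      induction k with
      | zero => simp
      | succ k ih => rw [pow_succ, Matrix.mul_assoc, h, ← Matrix.mul_assoc, ih, Matrix.mul_assoc,
          ← pow_succ]
    simp only [Polynomial.aeval_monomial, Algebra.algebraMap_eq_smul_one, Matrix.smul_mul,
      Matrix.one_mul, Matrix.mul_smul, hk]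

/-- For polynomials this is `(NᵀN)Nᵀ = Nᵀ(NNᵀ)` iterated. It carries functions of the large matrix
`NᵀN` over to functions of the Schur complement. -/
lemma cfc_transpose_mul_self_mul_transpose (f : ℝ → ℝ) (N : Matrix κ ι ℝ) :
    cfc f (Nᵀ * N) * Nᵀ = Nᵀ * cfc f (N * Nᵀ) := by
  obtain ⟨q, h₁, h₂⟩ := exists_polynomial_cfc f (isSelfAdjoint_transpose_mul_self N)
    (isSelfAdjoint_mul_transpose_self N)
  rw [h₁, h₂]
  exact aeval_mul_of_intertwine (Matrix.mul_assoc _ _ _) q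

/-- The quotient takes the value `0` at `x = 0` by convention, which is harmless because it is
multiplied by `x`. -/
lemma cfc_eq_smul_one_add_mul (f : ℝ → ℝ) {A : Matrix ι ι ℝ} (hA : IsSelfAdjoint A) :
    cfc f A = f 0 • 1 + A * cfc (fun x => (f x - f 0) / x) A := by
  have h : cfc f A = cfc (fun x => f 0 + x * ((f x - f 0) / x)) A := by
    refine cfc_congr fun x _ => ?_
    rcases eq_or_ne x 0 with rfl | hx
    · simp
    · field_simp; ring
  rw [h, cfc_const_add _ _ _ (continuousOn_spectrum _ _) hA,
    cfc_mul _ _ _ (continuousOn_spectrum _ _) (continuousOn_spectrum _ _), cfc_id' ℝ A hA,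
    Algebra.algebraMap_eq_smul_one]

lemma posDef_iff_spectrum_pos {A : Matrix ι ι ℝ} (hA : A.IsHermitian) :
    A.PosDef ↔ ∀ x ∈ spectrum ℝ A, 0 < x := by
  rw [hA.posDef_iff_eigenvalues_pos, hA.spectrum_real_eq_range_eigenvalues]
  simp

lemma posDef_cfc {f : ℝ → ℝ} {A : Matrix ι ι ℝ} (hA : IsSelfAdjoint A)
    (hf : ∀ x ∈ spectrum ℝ A, 0 < f x) : (cfc f A).PosDef := by
  rw [posDef_iff_spectrum_pos (A := cfc f A) (cfc_predicate f A : IsSelfAdjoint _),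
    cfc_map_spectrum f A hA (continuousOn_spectrum _ _)]
  rintro _ ⟨x, hx, rfl⟩
  exact hf x hx

lemma posDef_smul_one_sub_iff {A : Matrix ι ι ℝ} (hA : IsSelfAdjoint A) (c : ℝ) :
    (c • (1 : Matrix ι ι ℝ) - A).PosDef ↔ ∀ x ∈ spectrum ℝ A, x < c := by
  have h : c • (1 : Matrix ι ι ℝ) - A = cfc (fun x => c - x) A := by
    rw [cfc_sub (fun _ => c) (fun x : ℝ => x) A (continuousOn_spectrum _ _)
      (continuousOn_spectrum _ _), cfc_id' ℝ A hA, cfc_const c A hA,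
      Algebra.algebraMap_eq_smul_one]
  rw [h, posDef_iff_spectrum_pos (A := cfc _ A) (cfc_predicate _ A : IsSelfAdjoint _),
    cfc_map_spectrum _ A hA (continuousOn_spectrum _ _)]
  simp

lemma posDef_congr {K : Matrix ι ι ℝ} (hK : K.PosDef) {T : Matrix ι ι ℝ} (hT : IsUnit T) :
    (T * K * Tᵀ).PosDef := by
  refine hK.mul_mul_conjTranspose_same (B := T) ?_
  exact Matrix.vecMul_injective_iff_isUnit.2 hT

lemma isUnit_of_mul_transpose_posDef {L : Matrix ι ι ℝ} (h : (L * Lᵀ).PosDef) : IsUnit L := by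
  have h := (Matrix.isUnit_iff_isUnit_det _).1 h.isUnit
  rw [Matrix.det_mul] at h
  exact (Matrix.isUnit_iff_isUnit_det _).2 (isUnit_of_mul_isUnit_left h)

/-- The strict upper bounds of the spectra of `N Nᵀ` and `Nᵀ N` by `c > 0` agree. -/
lemma posDef_smul_one_sub_transpose_mul {N : Matrix κ ι ℝ} {c : ℝ} (hc : 0 < c)
    (h : (c • (1 : Matrix κ κ ℝ) - N * Nᵀ).PosDef) :
    (c • (1 : Matrix ι ι ℝ) - Nᵀ * N).PosDef := by
  refine Matrix.PosDef.of_dotProduct_mulVec_pos ?_ fun v hv => ?_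
  · exact (IsSelfAdjoint.smul (IsSelfAdjoint.all c) (.one _)).sub
      (isSelfAdjoint_transpose_mul_self N)
  have hvv : 0 < v ⬝ᵥ v := by
    simpa using dotProduct_star_self_pos_iff.2 hv
  have e₁ : v ⬝ᵥ ((Nᵀ * N) *ᵥ v) = (N *ᵥ v) ⬝ᵥ (N *ᵥ v) := by
    rw [← Matrix.mulVec_mulVec, Matrix.dotProduct_mulVec, Matrix.vecMul_transpose]
  have goal_eq : star v ⬝ᵥ ((c • (1 : Matrix ι ι ℝ) - Nᵀ * N) *ᵥ v)
      = c * (v ⬝ᵥ v) - (N *ᵥ v) ⬝ᵥ (N *ᵥ v) := by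
    simp [Matrix.sub_mulVec, Matrix.smul_mulVec, dotProduct_sub, e₁]
  rw [goal_eq]
  by_cases hw : N *ᵥ v = 0
  · simp only [hw, dotProduct_zero, sub_zero]; positivity
  set w := N *ᵥ v
  have hww : 0 < w ⬝ᵥ w := by
    simpa using dotProduct_star_self_pos_iff.2 hw
  have e₂ : w ⬝ᵥ w = v ⬝ᵥ (Nᵀ *ᵥ w) := by
    rw [Matrix.dotProduct_mulVec v, Matrix.vecMul_transpose]
  have e₃ : w ⬝ᵥ ((N * Nᵀ) *ᵥ w) = (Nᵀ *ᵥ w) ⬝ᵥ (Nᵀ *ᵥ w) := by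
    rw [← Matrix.mulVec_mulVec, Matrix.dotProduct_mulVec, ← Matrix.mulVec_transpose]
  have h₁ : (Nᵀ *ᵥ w) ⬝ᵥ (Nᵀ *ᵥ w) < c * (w ⬝ᵥ w) := by
    have := h.dotProduct_mulVec_pos hw
    simp [Matrix.sub_mulVec, Matrix.smul_mulVec, dotProduct_sub, e₃] at this
    linarith
  -- With `w = N v`, Cauchy–Schwarz bounds `‖w‖⁴ = (v · Nᵀw)²` by `‖v‖² ‖Nᵀw‖²`, and the hypothesis
  -- tested at `w` bounds `‖Nᵀw‖²` by `c ‖w‖²`.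
  have cs : (v ⬝ᵥ (Nᵀ *ᵥ w)) ^ 2 ≤ (v ⬝ᵥ v) * ((Nᵀ *ᵥ w) ⬝ᵥ (Nᵀ *ᵥ w)) := by
    simpa [dotProduct, sq] using
      Finset.sum_mul_sq_le_sq_mul_sq Finset.univ v (Nᵀ *ᵥ w)
  rw [← e₂] at cs
  by_contra! hcon
  have : (w ⬝ᵥ w) ^ 2 < (v ⬝ᵥ v) * (c * (w ⬝ᵥ w)) := cs.trans_lt (by gcongr)
  nlinarith

end FunctionalCalculus

/-! ### Klein's trace inequality -/

section Klein

variable {ι : Type*} [Fintype ι] [DecidableEq ι]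

/-- The matrix of squared inner products of the eigenvectors of `A` and `B`. -/
def eigenOverlap {A B : Matrix ι ι ℝ} (hA : A.IsHermitian) (hB : B.IsHermitian) (i j : ι) : ℝ :=
  ((star hA.eigenvectorUnitary.1 * hB.eigenvectorUnitary.1) i j) ^ 2

/-- Diagonalizing both matrices turns the trace into a sum over pairs of eigenvalues with
nonnegative weights, so scalar inequalities can be summed pair by pair even when `A` and `B` do not
commute. -/
lemma trace_cfc_mul_cfc {A B : Matrix ι ι ℝ} (hA : A.IsHermitian) (hB : B.IsHermitian)
    (f g : ℝ → ℝ) :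
    trace (cfc f A * cfc g B)
      = ∑ i, ∑ j, f (hA.eigenvalues i) * g (hB.eigenvalues j) * eigenOverlap hA hB i j := by
  rw [hA.cfc_eq, hB.cfc_eq]
  simp only [IsHermitian.cfc, Unitary.conjStarAlgAut_apply]
  set U : Matrix ι ι ℝ := hA.eigenvectorUnitary.1
  set W : Matrix ι ι ℝ := hB.eigenvectorUnitary.1
  set a : Matrix ι ι ℝ := diagonal (RCLike.ofReal ∘ f ∘ hA.eigenvalues) with ha
  set b : Matrix ι ι ℝ := diagonal (RCLike.ofReal ∘ g ∘ hB.eigenvalues) with hb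
  have h : trace (U * a * star U * (W * b * star W))
      = trace (a * (star U * W) * b * (star U * W)ᵀ) := by
    have : (star U * W)ᵀ = star W * U := by
      rw [Matrix.transpose_mul]
      simp [star_eq_conjTranspose]
    rw [this]
    calc trace (U * a * star U * (W * b * star W))
        = trace (U * (a * (star U * W) * b * star W)) := by simp only [Matrix.mul_assoc]
      _ = trace (a * (star U * W) * b * star W * U) := Matrix.trace_mul_comm _ _
      _ = _ := by simp only [Matrix.mul_assoc]
  rw [h]
  simp only [Matrix.trace, Matrix.diag_apply, Matrix.mul_apply (N := (star U * W)ᵀ),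
    Matrix.transpose_apply, ha, hb, Matrix.mul_diagonal, Matrix.diagonal_mul, eigenOverlap]
  refine Finset.sum_congr rfl fun i _ => Finset.sum_congr rfl fun j _ => ?_
  simp only [Function.comp, RCLike.ofReal_real_eq_id, id]
  ring

/-- Each trace has the form `tr(f(A) g(B))`, with constant or identity factors inserted where
needed. No relation between `h` and `h'` is used. -/
lemma trace_cfc_sub_sub_eq_sum {A B : Matrix ι ι ℝ} (hA : A.IsHermitian) (hB : B.IsHermitian)
    (h h' : ℝ → ℝ) :
    trace (cfc h A) - trace (cfc h B) - trace (cfc h' B * (A - B))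
      = ∑ i, ∑ j, (h (hA.eigenvalues i) - h (hB.eigenvalues j)
          - h' (hB.eigenvalues j) * (hA.eigenvalues i - hB.eigenvalues j))
          * eigenOverlap hA hB i j := by
  have one_eq : ∀ {C : Matrix ι ι ℝ}, C.IsHermitian → (1 : Matrix ι ι ℝ) = cfc (fun _ : ℝ => (1 : ℝ)) C :=
    fun hC => (cfc_const_one ℝ _ hC).symm
  have id_eq : ∀ {C : Matrix ι ι ℝ}, C.IsHermitian → cfc (fun x : ℝ => x) C = C :=
    fun hC => cfc_id' ℝ _ hC
  have e₁ : trace (cfc h A) = trace (cfc h A * cfc (fun _ : ℝ => (1 : ℝ)) B) := by rw [← one_eq hB, mul_one]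
  have e₂ : trace (cfc h B) = trace (cfc (fun _ : ℝ => (1 : ℝ)) A * cfc h B) := by rw [← one_eq hA, one_mul]
  have e₃ : trace (cfc h' B * A) = trace (cfc (fun x : ℝ => x) A * cfc h' B) := by
    rw [id_eq hA, Matrix.trace_mul_comm]
  have e₄ : trace (cfc h' B * B) = trace (cfc (fun _ : ℝ => (1 : ℝ)) A * cfc (fun x => h' x * x) B) := by
    rw [← one_eq hA, one_mul, cfc_mul _ _ _ (continuousOn_spectrum _ _) (continuousOn_spectrum _ _),
      id_eq hB]
  rw [Matrix.mul_sub, Matrix.trace_sub, e₁, e₂, e₃, e₄]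
  simp only [trace_cfc_mul_cfc hA hB, ← Finset.sum_sub_distrib]
  refine Finset.sum_congr rfl fun i _ => Finset.sum_congr rfl fun j _ => ?_
  ring

/-- **Klein's inequality**: `tr (h(A) - h(B) - h'(B)(A - B)) ≥ 0` if `h` lies above its tangents,
with equality only for `A = B` if it lies strictly above them. -/
lemma klein_inequality {A B : Matrix ι ι ℝ} (hA : A.IsHermitian) (hB : B.IsHermitian)
    {h h' : ℝ → ℝ}
    (hh : ∀ a ∈ spectrum ℝ A, ∀ b ∈ spectrum ℝ B, a ≠ b → 0 < h a - h b - h' b * (a - b)) :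
    0 ≤ trace (cfc h A) - trace (cfc h B) - trace (cfc h' B * (A - B)) ∧
    (trace (cfc h A) - trace (cfc h B) - trace (cfc h' B * (A - B)) = 0 → A = B) := by
  rw [trace_cfc_sub_sub_eq_sum hA hB]
  have hpos : ∀ i j, hA.eigenvalues i ≠ hB.eigenvalues j →
      0 < h (hA.eigenvalues i) - h (hB.eigenvalues j)
          - h' (hB.eigenvalues j) * (hA.eigenvalues i - hB.eigenvalues j) := fun i j hij =>
    hh _ (hA.eigenvalues_mem_spectrum_real i) _ (hB.eigenvalues_mem_spectrum_real j) hij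
  have hover : ∀ i j, 0 ≤ eigenOverlap hA hB i j := fun i j => sq_nonneg _
  have hnn : ∀ i j, 0 ≤ (h (hA.eigenvalues i) - h (hB.eigenvalues j)
          - h' (hB.eigenvalues j) * (hA.eigenvalues i - hB.eigenvalues j))
          * eigenOverlap hA hB i j := fun i j => by
    refine mul_nonneg ?_ (hover i j)
    by_cases hij : hA.eigenvalues i = hB.eigenvalues j
    · simp [hij]
    · exact (hpos i j hij).le
  refine ⟨Finset.sum_nonneg fun i _ => Finset.sum_nonneg fun j _ => hnn i j, fun h0 => ?_⟩
  have hz : ∀ i j, hA.eigenvalues i = hB.eigenvalues j ∨ eigenOverlap hA hB i j = 0 := by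
    intro i j
    have h1 := (Finset.sum_eq_zero_iff_of_nonneg
      fun i _ => Finset.sum_nonneg fun j _ => hnn i j).1 h0 i (Finset.mem_univ i)
    have h2 := (Finset.sum_eq_zero_iff_of_nonneg fun j _ => hnn i j).1 h1 j (Finset.mem_univ j)
    by_cases hij : hA.eigenvalues i = hB.eigenvalues j
    · exact Or.inl hij
    · exact Or.inr ((mul_eq_zero.1 h2).resolve_left (hpos i j hij).ne')
  -- Equality forces the overlap to vanish at every pair of distinct eigenvalues. This no longer
  -- depends on `h`, so the gap also vanishes for `x ↦ x²`, where it is the squared Frobenius norm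
  -- of `A - B`.
  have hsq : trace (cfc (fun x : ℝ => x ^ 2) A) - trace (cfc (fun x : ℝ => x ^ 2) B)
      - trace (cfc (fun x : ℝ => 2 * x) B * (A - B)) = 0 := by
    rw [trace_cfc_sub_sub_eq_sum hA hB]
    refine Finset.sum_eq_zero fun i _ => Finset.sum_eq_zero fun j _ => ?_
    rcases hz i j with hij | hij
    · simp [hij]
    · simp [hij]
  have e : trace ((A - B) * (A - B)ᴴ) = 0 := by
    have hAB : (A - B)ᴴ = A - B := hA.sub hB
    have hpow : ∀ {C : Matrix ι ι ℝ}, C.IsHermitian → cfc (fun x : ℝ => x ^ 2) C = C ^ 2 :=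
      fun hC => cfc_pow_id _ 2 hC
    have hmul : cfc (fun x : ℝ => 2 * x) B = (2 : ℝ) • B := cfc_const_mul_id 2 B hB
    rw [hpow hA, hpow hB, hmul] at hsq
    rw [hAB, ← hsq]
    simp only [sq, Matrix.mul_sub, Matrix.sub_mul, Matrix.trace_sub, Matrix.smul_mul,
      Matrix.trace_smul, smul_eq_mul, Matrix.trace_mul_comm A B]
    ring
  exact sub_eq_zero.1 (Matrix.trace_mul_conjTranspose_self_eq_zero_iff.1 e)

end Klein

/-! ### The scalar functions behind the tau-divergence and the tau-distortion -/

section Scalar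

/-- The function `h_τ` with `D_τ(N(m, K') ‖ N(m, K)) = tr h_τ(S)`. -/
def divFun (τ s : ℝ) : ℝ :=
  if τ = 0 then -Real.log s + s - 1
  else if τ = 1 then s * Real.log s - s + 1
  else -(1 / (τ * (1 - τ))) * s ^ τ + 1 / (1 - τ) * s + 1 / τ

/-- The derivative of `divFun τ` on the positive half line. -/
def divFunDeriv (τ s : ℝ) : ℝ :=
  if τ = 1 then Real.log s else (1 - s ^ (τ - 1)) / (1 - τ)

/-- The scalar function of the tau-distortion: the inverse of `divFunDeriv τ`, composed with the
multiplication by `θ`. -/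
def distortFun (τ θ s : ℝ) : ℝ :=
  if τ < 1 then (1 - θ * (1 - τ) * s) ^ (1 / (τ - 1)) else Real.exp (θ * s)

/-- Strict convexity in three forms: `log r < r - 1` at `r = a/b` for `τ = 0` and at `r = b/a` for
`τ = 1`, and the strict Bernoulli inequality for `(a/b)^τ` in between. -/
lemma divFun_tangent_lt {τ a b : ℝ} (hτ0 : 0 ≤ τ) (hτ1 : τ ≤ 1) (ha : 0 < a) (hb : 0 < b)
    (hab : a ≠ b) : 0 < divFun τ a - divFun τ b - divFunDeriv τ b * (a - b) := by
  rcases eq_or_ne τ 0 with rfl | h0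
  · have hr : a / b ≠ 1 := fun h => hab ((div_eq_one_iff_eq hb.ne').1 h)
    have := Real.log_lt_sub_one_of_pos (div_pos ha hb) hr
    rw [Real.log_div ha.ne' hb.ne'] at this
    simp only [divFun, divFunDeriv, if_true, zero_ne_one, if_false, zero_sub, sub_zero, div_one,
      Real.rpow_neg_one]
    have e : (1 - b⁻¹) * (a - b) = a - b - a / b + 1 := by field_simp; ring
    rw [e]; linarith
  rcases eq_or_ne τ 1 with rfl | h1
  · have hr : b / a ≠ 1 := fun h => hab ((div_eq_one_iff_eq ha.ne').1 h).symm
    have := mul_lt_mul_of_pos_left (Real.log_lt_sub_one_of_pos (div_pos hb ha) hr) ha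
    rw [Real.log_div hb.ne' ha.ne', mul_sub, mul_sub, mul_div_cancel₀ _ ha.ne'] at this
    simp only [divFun, divFunDeriv, if_true, one_ne_zero, if_false]
    linarith
  have p0 : 0 < τ := lt_of_le_of_ne hτ0 h0.symm
  have p1 : 0 < 1 - τ := sub_pos.2 (lt_of_le_of_ne hτ1 h1)
  have hr : a / b - 1 ≠ 0 := fun h => hab ((div_eq_one_iff_eq hb.ne').1 (sub_eq_zero.1 h))
  have hbern := rpow_one_add_lt_one_add_mul_self
    (s := a / b - 1) (by linarith [div_pos ha hb]) hr p0 (by linarith)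
  rw [add_sub_cancel, Real.div_rpow ha.le hb.le, div_lt_iff₀ (Real.rpow_pos_of_pos hb τ)] at hbern
  have hsub : b ^ (τ - 1) = b ^ τ / b := by rw [Real.rpow_sub hb, Real.rpow_one]
  simp only [divFun, divFunDeriv, if_neg h0, if_neg h1, hsub]
  have e : -(1 / (τ * (1 - τ))) * a ^ τ + 1 / (1 - τ) * a + 1 / τ
      - (-(1 / (τ * (1 - τ))) * b ^ τ + 1 / (1 - τ) * b + 1 / τ)
      - (1 - b ^ τ / b) / (1 - τ) * (a - b)
      = ((1 + τ * (a / b - 1)) * b ^ τ - a ^ τ) / (τ * (1 - τ)) := by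
    field_simp; ring
  rw [e]
  exact div_pos (by linarith) (mul_pos p0 p1)

lemma distortFun_zero (τ θ : ℝ) : distortFun τ θ 0 = 1 := by
  simp [distortFun]

/-- `s < (θ(1-τ))⁻¹`, for `τ < 1`. -/
def BelowThresholdScalar (τ θ s : ℝ) : Prop := τ < 1 → s < (θ * (1 - τ))⁻¹

lemma BelowThresholdScalar.pos {τ θ s : ℝ} (hθ : 0 < θ) (h : BelowThresholdScalar τ θ s)
    (hτ : τ < 1) : 0 < 1 - θ * (1 - τ) * s := by
  have hc : 0 < θ * (1 - τ) := mul_pos hθ (sub_pos.2 hτ)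
  have := h hτ
  have := mul_lt_mul_of_pos_left this hc
  rw [mul_inv_cancel₀ hc.ne'] at this
  linarith

lemma distortFun_pos {τ θ s : ℝ} (hθ : 0 < θ) (h : BelowThresholdScalar τ θ s) :
    0 < distortFun τ θ s := by
  unfold distortFun
  split_ifs with hτ
  · exact Real.rpow_pos_of_pos (h.pos hθ hτ) _
  · exact Real.exp_pos _

/-- The scalar first-order condition of the maximization. The threshold keeps the base of the real
power positive, so the exponents `1/(τ-1)` and `τ-1` cancel. -/
lemma divFunDeriv_distortFun {τ θ s : ℝ} (hτ1 : τ ≤ 1) (hθ : 0 < θ)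
    (h : BelowThresholdScalar τ θ s) : divFunDeriv τ (distortFun τ θ s) = θ * s := by
  unfold distortFun divFunDeriv
  rcases hτ1.lt_or_eq with hτ | rfl
  · have h1 : τ - 1 ≠ 0 := (sub_neg.2 hτ).ne
    have h2 : 1 - τ ≠ 0 := (sub_pos.2 hτ).ne'
    rw [if_pos hτ, if_neg hτ.ne, ← Real.rpow_mul (h.pos hθ hτ).le, one_div_mul_cancel h1,
      Real.rpow_one]
    field_simp
    ring
  · simp

end Scalar

/-! ### The tau-distortion in terms of `P` -/

section DistortionFormula

variable {n : ℕ}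

lemma distortFactor_eq_mul_cfc (τ θ : ℝ) (L : Matrix (Fin n) (Fin n) ℝ) :
    distortFactor τ θ L = L * cfc (distortFun τ θ) (Lᵀ * L) * Lᵀ := by
  have hL := isSelfAdjoint_transpose_mul_self L
  unfold distortFactor
  split_ifs with hτ
  · congr 2
    have h : 1 - (θ * (1 - τ)) • (Lᵀ * L) = cfc (fun s => 1 - θ * (1 - τ) * s) (Lᵀ * L) := by
      rw [cfc_sub (fun _ => (1 : ℝ)) (fun s => θ * (1 - τ) * s) _ (continuousOn_spectrum _ _)
        (continuousOn_spectrum _ _), cfc_const_one ℝ _ hL]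
      congr 1
      exact (cfc_const_mul_id (θ * (1 - τ)) (Lᵀ * L) hL).symm
    rw [h, ← cfc_comp' _ _ _ (continuousOn_image_spectrum _ _ _) (continuousOn_spectrum _ _) hL]
    exact cfc_congr fun s _ => by simp [distortFun, hτ]
  · congr 2
    have hθ : IsSelfAdjoint (θ • (Lᵀ * L)) := IsSelfAdjoint.smul (IsSelfAdjoint.all θ) hL
    have hexp : NormedSpace.exp (θ • (Lᵀ * L)) = cfc Real.exp (θ • (Lᵀ * L)) := by
      -- Identifying the exponential series with the functional calculus uses the operator norm on
      -- matrices, chosen for this step only.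
      open Matrix.Norms.L2Operator in
      exact (CFC.real_exp_eq_normedSpace_exp (a := θ • (Lᵀ * L)) hθ).symm
    rw [hexp, ← cfc_comp_const_mul θ Real.exp _ (continuousOn_image_spectrum _ _ _) hL]
    exact cfc_congr fun s _ => by simp [distortFun, hτ]

/-- The right side sees only `L Lᵀ`; this is the independence of the choice of factor. -/
lemma distortFactor_eq_cfc_mul (τ θ : ℝ) (L : Matrix (Fin n) (Fin n) ℝ) :
    distortFactor τ θ L = cfc (distortFun τ θ) (L * Lᵀ) * (L * Lᵀ) := by
  rw [distortFactor_eq_mul_cfc, Matrix.mul_assoc, cfc_transpose_mul_self_mul_transpose,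
    ← Matrix.mul_assoc]
  exact ((Commute.refl (L * Lᵀ)).cfc_real (distortFun τ θ)).eq.symm

lemma sqrt_mul_sqrt_transpose {P : Matrix (Fin n) (Fin n) ℝ} (hP : P.PosSemidef) :
    cfc Real.sqrt P * (cfc Real.sqrt P)ᵀ = P := by
  have hsa : IsSelfAdjoint P := hP.1
  rw [cfc_transpose, ← cfc_mul _ _ _ (continuousOn_spectrum _ _) (continuousOn_spectrum _ _)]
  conv_rhs => rw [← cfc_id' ℝ P hsa]
  refine cfc_congr fun x hx => Real.mul_self_sqrt ?_
  have hx' := hx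
  rw [hP.1.spectrum_real_eq_range_eigenvalues] at hx'
  obtain ⟨i, rfl⟩ := hx'
  exact hP.eigenvalues_nonneg i

lemma distort_eq_cfc_mul (τ θ : ℝ) {P : Matrix (Fin n) (Fin n) ℝ} (hP : P.PosSemidef) :
    distort τ θ P = cfc (distortFun τ θ) P * P := by
  rw [distort, distortFactor_eq_cfc_mul, sqrt_mul_sqrt_transpose hP]

/-- The threshold is imposed on `NNᵀ`, while the optimization takes place on the side of `NᵀN`. Only
zero eigenvalues can be added in passing, and the bound is positive. -/
lemma belowThresholdScalar_of_mem_spectrum_transpose_mul {ι : Type*} [Fintype ι] [DecidableEq ι] {τ θ : ℝ}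
    (hθ : 0 < θ) {N : Matrix (Fin n) ι ℝ} (h : BelowThreshold τ θ (N * Nᵀ)) :
    ∀ s ∈ spectrum ℝ (Nᵀ * N), BelowThresholdScalar τ θ s := fun s hs hτ =>
  (posDef_smul_one_sub_iff (isSelfAdjoint_transpose_mul_self N) _).1
    (posDef_smul_one_sub_transpose_mul (inv_pos.2 (mul_pos hθ (sub_pos.2 hτ))) (h hτ)) s hs

lemma posDef_distortFactor {τ θ : ℝ} (hθ : 0 < θ) {L : Matrix (Fin n) (Fin n) ℝ}
    (hL : (L * Lᵀ).PosDef) (h : BelowThreshold τ θ (L * Lᵀ)) : (distortFactor τ θ L).PosDef := by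
  rw [distortFactor_eq_mul_cfc]
  exact posDef_congr (posDef_cfc (isSelfAdjoint_transpose_mul_self L) fun s hs =>
    distortFun_pos hθ (belowThresholdScalar_of_mem_spectrum_transpose_mul hθ h s hs)) (isUnit_of_mul_transpose_posDef hL)

lemma posDef_one_sub_smul_transpose_mul {τ θ : ℝ} (hθ : 0 < θ) (hτ : τ < 1)
    {L : Matrix (Fin n) (Fin n) ℝ} (h : BelowThreshold τ θ (L * Lᵀ)) :
    (1 - (θ * (1 - τ)) • (Lᵀ * L)).PosDef := by
  have hc : 0 < θ * (1 - τ) := mul_pos hθ (sub_pos.2 hτ)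
  have := (posDef_smul_one_sub_transpose_mul (inv_pos.2 hc) (h hτ)).smul hc
  rwa [smul_sub, smul_smul, mul_inv_cancel₀ hc.ne', one_smul] at this

lemma distort_wellDefined {τ θ : ℝ} (hθ : 0 < θ) {P : Matrix (Fin n) (Fin n) ℝ} (hP : P.PosDef)
    (h : BelowThreshold τ θ P) :
    (distort τ θ P).PosDef ∧ (∃ L, L * Lᵀ = P) ∧
      ∀ L, L * Lᵀ = P →
        (τ < 1 → (1 - (θ * (1 - τ)) • (Lᵀ * L)).PosDef) ∧
        distort τ θ P = distortFactor τ θ L := by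
  have hs := sqrt_mul_sqrt_transpose hP.posSemidef
  refine ⟨posDef_distortFactor hθ (by rwa [hs]) (by rwa [hs]), ⟨_, hs⟩, ?_⟩
  rintro L rfl
  refine ⟨fun hτ => posDef_one_sub_smul_transpose_mul hθ hτ h, ?_⟩
  rw [distort_eq_cfc_mul τ θ hP.posSemidef, distortFactor_eq_cfc_mul]

end DistortionFormula

/-! ### The tau-divergence as a trace -/

section DivergenceFormula

variable {ι : Type} [Fintype ι] [DecidableEq ι]

lemma normalizedCov_congr {L K' : Matrix ι ι ℝ} (hL : IsUnit L) :
    L * normalizedCov L K' * Lᵀ = K' := by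
  have hd := (Matrix.isUnit_iff_isUnit_det _).1 hL
  have hLT : L⁻¹ᵀ * Lᵀ = 1 := by
    rw [← Matrix.transpose_mul, Matrix.mul_nonsing_inv _ hd, Matrix.transpose_one]
  simp only [normalizedCov, Matrix.mul_assoc, hLT, Matrix.mul_one]
  rw [Matrix.mul_nonsing_inv_cancel_left _ _ hd]

lemma normalizedCov_of_congr {L S : Matrix ι ι ℝ} (hL : IsUnit L) :
    normalizedCov L (L * S * Lᵀ) = S := by
  have hd := (Matrix.isUnit_iff_isUnit_det _).1 hL
  have hLT : Lᵀ * L⁻¹ᵀ = 1 := by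
    rw [← Matrix.transpose_mul, Matrix.nonsing_inv_mul _ hd, Matrix.transpose_one]
  simp only [normalizedCov, Matrix.mul_assoc, hLT, Matrix.mul_one]
  rw [Matrix.nonsing_inv_mul_cancel_left _ _ hd]

lemma posDef_normalizedCov {L K' : Matrix ι ι ℝ} (hL : IsUnit L) (hK' : K'.PosDef) :
    (normalizedCov L K').PosDef :=
  posDef_congr hK' (by simpa using hL)

lemma trace_mul_inv_eq_trace_normalizedCov (L K' : Matrix ι ι ℝ) :
    trace (K' * (L * Lᵀ)⁻¹) = trace (normalizedCov L K') := by
  rw [Matrix.mul_inv_rev, ← Matrix.mul_assoc, Matrix.trace_mul_comm, normalizedCov,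
    Matrix.transpose_nonsing_inv, Matrix.mul_assoc]

/-- The contribution of the means to the tau-divergence, when it is finite. -/
def meanDiv (τ : ℝ) (L : Matrix ι ι ℝ) (v : E ι) : ℝ :=
  if τ = 1 then 0 else 1 / (1 - τ) * weightedSq (L * Lᵀ)⁻¹ v

lemma trace_cfc_divFun (τ : ℝ) {S : Matrix ι ι ℝ} (hS : IsSelfAdjoint S) :
    trace (cfc (divFun τ) S) =
      if τ = 0 then trace (-(cfc Real.log S) + S - 1)
      else if τ = 1 then trace (S * cfc Real.log S - S + 1)
      else trace (-((1 / (τ * (1 - τ))) • cfc (fun s : ℝ => s ^ τ) S)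
        + (1 / (1 - τ)) • S + (1 / τ) • (1 : Matrix ι ι ℝ)) := by
  have hc := fun f => continuousOn_spectrum f S
  split_ifs with h0 h1
  · have e : divFun τ = fun s => -Real.log s + s - 1 := by ext s; simp [divFun, h0]
    rw [e, cfc_sub _ _ _ (hc _) (hc _), cfc_add _ _ _ (hc _) (hc _), cfc_neg, cfc_id' ℝ S hS,
      cfc_const_one ℝ S hS]
  · have e : divFun τ = fun s => s * Real.log s - s + 1 := by ext s; simp [divFun, h1]
    rw [e, cfc_add _ _ _ (hc _) (hc _), cfc_sub _ _ _ (hc _) (hc _),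
      cfc_mul _ _ _ (hc _) (hc _), cfc_id' ℝ S hS, cfc_const_one ℝ S hS]
  · have e : divFun τ = fun s => -(1 / (τ * (1 - τ)) * s ^ τ) + 1 / (1 - τ) * s + 1 / τ := by
      ext s; simp [divFun, h0, h1]
    rw [e, cfc_add _ _ _ (hc _) (hc _), cfc_add _ _ _ (hc _) (hc _), cfc_neg,
      cfc_const_mul _ _ _ (hc _), cfc_const_mul _ _ _ (hc _), cfc_id' ℝ S hS,
      cfc_const _ S hS, Algebra.algebraMap_eq_smul_one]

lemma weightedSq_smul {ι : Type} [Fintype ι] (c : ℝ) (W : Matrix ι ι ℝ) (v : E ι) :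
    weightedSq (c • W) v = c * weightedSq W v := by
  simp [weightedSq, Matrix.smul_mulVec]

lemma tauDiv_lt_top_iff {τ : ℝ} {L K' : Matrix ι ι ℝ} {m m' : E ι} :
    tauDiv τ m L m' K' < ⊤ ↔ (τ = 1 → m' = m) := by
  unfold tauDiv
  dsimp only
  split_ifs with h0 h1
  · simp only [EReal.coe_lt_top, h0, zero_ne_one, false_imp_iff]
  · simp only [h1, deltaInfty, sub_eq_zero, forall_const]
    split_ifs with hm
    · simp only [zero_add, hm, iff_true]; exact EReal.coe_lt_top _
    · simp only [EReal.top_add_coe, lt_self_iff_false, hm]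
  · simp only [EReal.coe_lt_top, h1, false_imp_iff]

/-- Mean and covariance decouple, so they can be maximized separately; by cyclicity, `tr(K'K⁻¹)`
becomes `tr S`. -/
lemma tauDiv_toReal {τ : ℝ} {L K' : Matrix ι ι ℝ} {m m' : E ι} (hL : IsUnit L)
    (hK' : K'.PosDef) (h : tauDiv τ m L m' K' < ⊤) :
    (tauDiv τ m L m' K').toReal
      = meanDiv τ L (m' - m) + trace (cfc (divFun τ) (normalizedCov L K')) := by
  rw [tauDiv_lt_top_iff] at h
  have hS : IsSelfAdjoint (normalizedCov L K') := (posDef_normalizedCov hL hK').1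
  have ht := trace_mul_inv_eq_trace_normalizedCov L K'
  rw [trace_cfc_divFun τ hS]
  unfold tauDiv meanDiv
  dsimp only
  split_ifs with h0 h1 h1
  · exact absurd (h0.symm.trans h1) zero_ne_one
  · rw [EReal.toReal_coe, h0]
    simp only [Matrix.trace_add, Matrix.trace_sub, ht]
    ring
  · rw [h h1, sub_self, deltaInfty, if_pos rfl, zero_add, EReal.toReal_coe]
    simp only [Matrix.trace_add, Matrix.trace_sub, ht]
    ring
  · rw [EReal.toReal_coe, weightedSq_smul]
    simp only [Matrix.trace_add, Matrix.trace_smul, ht]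

end DivergenceFormula

/-! ### The least favorable Gaussian density of a linear error -/

section LeastFavorable

variable {ι : Type} [Fintype ι] [DecidableEq ι] {n : ℕ}

/-- Over positive definite `S`, the penalized trace `tr(NᵀN S) - θ⁻¹ tr h_τ(S)` is maximal
exactly at the distortion function of `NᵀN`. -/
lemma penalizedTrace_le {τ θ : ℝ} (hτ0 : 0 ≤ τ) (hτ1 : τ ≤ 1) (hθ : 0 < θ)
    {N : Matrix (Fin n) ι ℝ} (h : BelowThreshold τ θ (N * Nᵀ)) {S : Matrix ι ι ℝ}
    (hS : S.PosDef) :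
    trace (Nᵀ * N * S) - θ⁻¹ * trace (cfc (divFun τ) S)
      ≤ trace (Nᵀ * N * cfc (distortFun τ θ) (Nᵀ * N))
        - θ⁻¹ * trace (cfc (divFun τ) (cfc (distortFun τ θ) (Nᵀ * N))) ∧
    (trace (Nᵀ * N * S) - θ⁻¹ * trace (cfc (divFun τ) S)
      = trace (Nᵀ * N * cfc (distortFun τ θ) (Nᵀ * N))
        - θ⁻¹ * trace (cfc (divFun τ) (cfc (distortFun τ θ) (Nᵀ * N))) →
      S = cfc (distortFun τ θ) (Nᵀ * N)) := by
  have hW := isSelfAdjoint_transpose_mul_self N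
  have hsc := belowThresholdScalar_of_mem_spectrum_transpose_mul hθ h
  have hS₀ : (cfc (distortFun τ θ) (Nᵀ * N)).PosDef :=
    posDef_cfc hW fun s hs => distortFun_pos hθ (hsc s hs)
  -- The matrix first-order condition: it makes the linear term of Klein's inequality at `S₀` equal
  -- to the linear term of the objective, multiplied by `θ`.
  have hderiv : cfc (divFunDeriv τ) (cfc (distortFun τ θ) (Nᵀ * N)) = θ • (Nᵀ * N) := by
    rw [← cfc_comp' _ _ _ (continuousOn_image_spectrum _ _ _) (continuousOn_spectrum _ _) hW,
      ← cfc_const_mul_id θ (Nᵀ * N) hW]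
    exact cfc_congr fun s hs => divFunDeriv_distortFun hτ1 hθ (hsc s hs)
  set S₀ := cfc (distortFun τ θ) (Nᵀ * N)
  obtain ⟨hk, hk0⟩ := klein_inequality (h := divFun τ) (h' := divFunDeriv τ) hS.1 hS₀.1
    fun a ha b hb => divFun_tangent_lt hτ0 hτ1 ((posDef_iff_spectrum_pos hS.1).1 hS a ha)
      ((posDef_iff_spectrum_pos hS₀.1).1 hS₀ b hb)
  rw [hderiv, Matrix.smul_mul, Matrix.trace_smul, Matrix.mul_sub, Matrix.trace_sub,
    smul_eq_mul] at hk hk0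
  have key : trace (Nᵀ * N * S₀) - θ⁻¹ * trace (cfc (divFun τ) S₀)
      - (trace (Nᵀ * N * S) - θ⁻¹ * trace (cfc (divFun τ) S))
      = θ⁻¹ * (trace (cfc (divFun τ) S) - trace (cfc (divFun τ) S₀)
        - θ * (trace (Nᵀ * N * S) - trace (Nᵀ * N * S₀))) := by
    field_simp; ring
  refine ⟨?_, fun he => hk0 ?_⟩
  · have := mul_nonneg (inv_pos.2 hθ).le hk
    linarith
  · rw [he, sub_self] at key
    exact (mul_eq_zero.1 key.symm).resolve_left (inv_pos.2 hθ).ne'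

lemma weightedSq_inv_mul_transpose {L : Matrix ι ι ℝ} (v : E ι) :
    weightedSq (L * Lᵀ)⁻¹ v = (L⁻¹ *ᵥ v.ofLp) ⬝ᵥ (L⁻¹ *ᵥ v.ofLp) := by
  rw [weightedSq, Matrix.mul_inv_rev, ← Matrix.mulVec_mulVec, ← Matrix.transpose_nonsing_inv,
    Matrix.dotProduct_mulVec, Matrix.vecMul_transpose]

/-- Shifting the mean never pays. For `τ < 1`, substituting `v = L u` turns the expression into
minus the quadratic form of `(θ(1-τ))⁻¹ I - NᵀN` with `N = M L`, which the threshold makes positive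
definite. -/
lemma dotProduct_mulVec_le_meanDiv {τ θ : ℝ} (hτ1 : τ ≤ 1) (hθ : 0 < θ)
    {M : Matrix (Fin n) ι ℝ} {L : Matrix ι ι ℝ} (hL : IsUnit L)
    (h : BelowThreshold τ θ ((M * L) * (M * L)ᵀ)) {v : E ι} (hv : τ = 1 → v = 0) :
    (M *ᵥ v.ofLp) ⬝ᵥ (M *ᵥ v.ofLp) - θ⁻¹ * meanDiv τ L v ≤ 0 ∧
    ((M *ᵥ v.ofLp) ⬝ᵥ (M *ᵥ v.ofLp) - θ⁻¹ * meanDiv τ L v = 0 → v = 0) := by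
  unfold meanDiv
  rcases eq_or_ne τ 1 with h1 | h1
  · simp [hv h1, h1]
  have hτ : τ < 1 := lt_of_le_of_ne hτ1 h1
  have hd := (Matrix.isUnit_iff_isUnit_det _).1 hL
  have hc : 0 < θ * (1 - τ) := mul_pos hθ (sub_pos.2 hτ)
  have hpd := posDef_smul_one_sub_transpose_mul (inv_pos.2 hc) (h hτ)
  set u := L⁻¹ *ᵥ v.ofLp with hu
  have hLu : L *ᵥ u = v.ofLp := by
    rw [hu, Matrix.mulVec_mulVec, Matrix.mul_nonsing_inv _ hd, Matrix.one_mulVec]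
  have e : (M *ᵥ v.ofLp) ⬝ᵥ (M *ᵥ v.ofLp) - θ⁻¹ * (1 / (1 - τ) * weightedSq (L * Lᵀ)⁻¹ v)
      = -(star u ⬝ᵥ (((θ * (1 - τ))⁻¹ • (1 : Matrix ι ι ℝ) - (M * L)ᵀ * (M * L)) *ᵥ u)) := by
    have e₁ : u ⬝ᵥ (((M * L)ᵀ * (M * L)) *ᵥ u) = (M *ᵥ v.ofLp) ⬝ᵥ (M *ᵥ v.ofLp) := by
      rw [← Matrix.mulVec_mulVec, Matrix.dotProduct_mulVec, Matrix.vecMul_transpose,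
        ← Matrix.mulVec_mulVec, hLu]
    simp only [weightedSq_inv_mul_transpose, star_trivial, Matrix.sub_mulVec, Matrix.smul_mulVec,
      dotProduct_sub, e₁, Matrix.one_mulVec, dotProduct_smul, smul_eq_mul, mul_inv]
    ring
  rw [if_neg h1, e]
  refine ⟨neg_nonpos.2 (hpd.posSemidef.dotProduct_mulVec_nonneg u), fun h0 => ?_⟩
  by_contra hv0
  have hu0 : u ≠ 0 := fun hu0 => hv0 (by
    rw [hu0, Matrix.mulVec_zero] at hLu
    exact (WithLp.ofLp_eq_zero 2).1 hLu.symm)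
  exact (hpd.dotProduct_mulVec_pos hu0).ne' (neg_eq_zero.1 h0)

end LeastFavorable

/-! ### Affine images and sums of Gaussian laws -/

section GaussianAffine

lemma toEuclideanLin_eq_toLp {ι κ : Type} [Fintype ι] [DecidableEq ι] (A : Matrix κ ι ℝ)
    (x : E ι) : toEuclideanLin A x = WithLp.toLp 2 (A *ᵥ x.ofLp) := rfl

lemma measurable_toEuclideanLin {ι κ : Type} [Fintype ι] [DecidableEq ι] [Fintype κ]
    (A : Matrix κ ι ℝ) : Measurable (toEuclideanLin A) :=
  (LinearMap.continuous_of_finiteDimensional _).measurable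

lemma posSemidef_congr {ι κ : Type} [Fintype ι] [Fintype κ] {S : Matrix ι ι ℝ}
    (hS : S.PosSemidef) (A : Matrix κ ι ℝ) : (A * S * Aᵀ).PosSemidef :=
  hS.mul_mul_conjTranspose_same A

lemma memLp_two_affine {ι κ : Type} [Fintype ι] [DecidableEq ι] [Fintype κ] (S : Matrix ι ι ℝ)
    (μ : E ι) (A : Matrix κ ι ℝ) (b : E κ) :
    MemLp (fun x => toEuclideanLin A x + b) 2 (multivariateGaussian μ S) :=
  ((LinearMap.toContinuousLinearMap (toEuclideanLin A)).comp_memLp'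
    IsGaussian.memLp_two_id).add (memLp_const b)

variable {ι κ : Type} [Fintype ι] [DecidableEq ι] [Fintype κ] [DecidableEq κ]

lemma inner_toEuclideanLin (A : Matrix κ ι ℝ) (x : E ι) (t : E κ) :
    inner ℝ (toEuclideanLin A x) t = inner ℝ x (toEuclideanLin Aᵀ t) := by
  simp only [toEuclideanLin_eq_toLp, EuclideanSpace.inner_eq_star_dotProduct, star_trivial]
  rw [Matrix.dotProduct_mulVec, ← Matrix.mulVec_transpose, dotProduct_comm]

/-- Comparing characteristic functions avoids densities and so covers singular covariances, which
`V₀` may have. -/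
lemma map_multivariateGaussian {S : Matrix ι ι ℝ} (hS : S.PosSemidef) (μ : E ι)
    (A : Matrix κ ι ℝ) (b : E κ) :
    (multivariateGaussian μ S).map (fun x => toEuclideanLin A x + b)
      = multivariateGaussian (toEuclideanLin A μ + b) (A * S * Aᵀ) := by
  have hA := measurable_toEuclideanLin A
  have : IsProbabilityMeasure ((multivariateGaussian μ S).map
      (fun x => toEuclideanLin A x + b)) :=
    Measure.isProbabilityMeasure_map (hA.add_const b).aemeasurable
  refine Measure.ext_of_charFun (funext fun t => ?_)
  rw [charFun_multivariateGaussian (posSemidef_congr hS A), charFun_apply,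
    integral_map (hA.add_const b).aemeasurable (by fun_prop)]
  have e : ∀ x, Complex.exp ((inner ℝ (toEuclideanLin A x + b) t : ℝ) * Complex.I)
      = Complex.exp ((inner ℝ x (toEuclideanLin Aᵀ t) : ℝ) * Complex.I)
        * Complex.exp ((inner ℝ b t : ℝ) * Complex.I) := fun x => by
    rw [← Complex.exp_add, inner_add_left, inner_toEuclideanLin]
    push_cast; ring_nf
  simp_rw [e]
  rw [integral_mul_const, ← charFun_apply, charFun_multivariateGaussian hS, ← Complex.exp_add,
    inner_add_right, ← real_inner_comm t (toEuclideanLin A μ), inner_toEuclideanLin A,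
    ← real_inner_comm t b, ← real_inner_comm (toEuclideanLin Aᵀ t) μ]
  have q : (toEuclideanLin Aᵀ t).ofLp ⬝ᵥ S *ᵥ (toEuclideanLin Aᵀ t).ofLp
      = t.ofLp ⬝ᵥ (A * S * Aᵀ) *ᵥ t.ofLp := by
    simp only [toEuclideanLin_eq_toLp, ← Matrix.mulVec_mulVec]
    rw [Matrix.dotProduct_mulVec t.ofLp, ← Matrix.mulVec_transpose]
  rw [q]
  congr 1
  push_cast
  ring

lemma multivariateGaussian_conv {S T : Matrix ι ι ℝ} (hS : S.PosSemidef) (hT : T.PosSemidef)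
    (μ ν : E ι) :
    multivariateGaussian μ S ∗ multivariateGaussian ν T = multivariateGaussian (μ + ν) (S + T) := by
  refine Measure.ext_of_charFun (funext fun t => ?_)
  rw [charFun_conv, charFun_multivariateGaussian hS, charFun_multivariateGaussian hT,
    charFun_multivariateGaussian (hS.add hT), ← Complex.exp_add, inner_add_right,
    Matrix.add_mulVec, dotProduct_add]
  congr 1
  push_cast
  ring

/-- The law of `A X + B W` for independent `X ∼ N(μ, S)` and `W ∼ N(0, I)`. -/
lemma map_prod_stdGaussian {ν : Type} [Fintype ν] [DecidableEq ν] {S : Matrix ι ι ℝ}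
    (hS : S.PosSemidef) (μ : E ι) (A : Matrix κ ι ℝ) (B : Matrix κ ν ℝ) :
    ((multivariateGaussian μ S).prod (stdGaussian (E ν))).map
        (fun w => toEuclideanLin A w.1 + toEuclideanLin B w.2)
      = multivariateGaussian (toEuclideanLin A μ) (A * S * Aᵀ + B * Bᵀ) := by
  have hA := measurable_toEuclideanLin A
  have hB := measurable_toEuclideanLin B
  have h₁ := map_multivariateGaussian hS μ A 0
  have h₂ := map_multivariateGaussian (Matrix.PosSemidef.one (n := ν) (R := ℝ)) 0 B 0
  simp only [add_zero, map_zero, Matrix.mul_one, multivariateGaussian_zero_one] at h₁ h₂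
  rw [show (fun w : E ι × E ν => toEuclideanLin A w.1 + toEuclideanLin B w.2)
      = (fun w : E κ × E κ => w.1 + w.2) ∘ Prod.map (toEuclideanLin A) (toEuclideanLin B) from rfl,
    ← Measure.map_map (by fun_prop) (hA.prodMap hB), ← Measure.map_prod_map _ _ hA hB]
  have hB' : (B * Bᵀ).PosSemidef := Matrix.posSemidef_self_mul_conjTranspose B
  have := multivariateGaussian_conv (posSemidef_congr hS A) hB' (toEuclideanLin A μ) 0
  rw [add_zero] at this
  rw [← this, ← h₁, ← h₂]
  rfl

lemma integral_norm_sq_multivariateGaussian {S : Matrix ι ι ℝ} (hS : S.PosSemidef) (μ : E ι) :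
    ∫ x, ‖x‖ ^ 2 ∂(multivariateGaussian μ S) = μ.ofLp ⬝ᵥ μ.ofLp + trace S := by
  have hm : ∀ i, MemLp (fun x : E ι => x i) 2 (multivariateGaussian μ S) := fun i =>
    (EuclideanSpace.proj (𝕜 := ℝ) i).comp_memLp' IsGaussian.memLp_two_id
  have hi : ∀ i, ∫ x : E ι, x i ∂(multivariateGaussian μ S) = μ i := fun i => by
    have := (EuclideanSpace.proj (𝕜 := ℝ) i).integral_comp_comm
      (IsGaussian.integrable_id (μ := multivariateGaussian μ S))
    simpa using this
  simp_rw [EuclideanSpace.real_norm_sq_eq]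
  rw [integral_finsetSum _ fun i _ => (hm i).integrable_sq]
  simp only [dotProduct, trace, diag_apply, ← Finset.sum_add_distrib]
  refine Finset.sum_congr rfl fun i _ => ?_
  have hv := variance_eval_multivariateGaussian (μ := μ) hS i
  rw [variance_eq_sub (hm i), hi] at hv
  simp only [Pi.pow_apply] at hv
  linarith

lemma integral_norm_sq_affine {S : Matrix ι ι ℝ} (hS : S.PosSemidef) (μ : E ι)
    (A : Matrix κ ι ℝ) (b : E κ) :
    ∫ x, ‖toEuclideanLin A x + b‖ ^ 2 ∂(multivariateGaussian μ S)
      = (toEuclideanLin A μ + b).ofLp ⬝ᵥ (toEuclideanLin A μ + b).ofLp + trace (A * S * Aᵀ) := by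
  rw [← integral_norm_sq_multivariateGaussian (posSemidef_congr hS A),
    ← map_multivariateGaussian hS, integral_map _ (by fun_prop)]
  exact ((measurable_toEuclideanLin A).add_const b).aemeasurable

/-- Uncorrelated linear images of a Gaussian vector are independent. -/
lemma indepFun_toEuclideanLin {ν : Type} [Fintype ν] [DecidableEq ν] {S : Matrix ι ι ℝ}
    (hS : S.PosSemidef) (μ : E ι) {A : Matrix κ ι ℝ} {B : Matrix ν ι ℝ} (h : A * S * Bᵀ = 0) :
    IndepFun (toEuclideanLin A) (toEuclideanLin B) (multivariateGaussian μ S) := by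
  have hg : HasGaussianLaw (fun x : E ι => (toEuclideanLin A x, toEuclideanLin B x))
      (multivariateGaussian μ S) :=
    IsGaussian.hasGaussianLaw_id.map ((LinearMap.toContinuousLinearMap (toEuclideanLin A)).prod
      (LinearMap.toContinuousLinearMap (toEuclideanLin B)))
  refine hg.indepFun_of_covariance_inner fun x y => ?_
  have e₁ : ∀ z, inner ℝ x (toEuclideanLin A z) = inner ℝ (toEuclideanLin Aᵀ x) z := fun z => by
    rw [← real_inner_comm, inner_toEuclideanLin, ← real_inner_comm]
  have e₂ : ∀ z, inner ℝ y (toEuclideanLin B z) = inner ℝ (toEuclideanLin Bᵀ y) z := fun z => by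
    rw [← real_inner_comm, inner_toEuclideanLin, ← real_inner_comm]
  simp_rw [e₁, e₂]
  rw [← covarianceBilin_apply_eq_cov IsGaussian.memLp_two_id,
    covarianceBilin_multivariateGaussian hS]
  simp only [toEuclideanLin_eq_toLp]
  rw [Matrix.mulVec_transpose, ← Matrix.dotProduct_mulVec, Matrix.mulVec_mulVec,
    Matrix.mulVec_mulVec, h, Matrix.zero_mulVec, dotProduct_zero]

end GaussianAffine

/-! ### Nondegenerate Gaussian laws and Lebesgue measure -/

section AbsolutelyContinuous

lemma pi_absolutelyContinuous : ∀ {n : ℕ} {μ ν : Fin n → Measure ℝ} [∀ i, SigmaFinite (μ i)]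
    [∀ i, SigmaFinite (ν i)], (∀ i, μ i ≪ ν i) → Measure.pi μ ≪ Measure.pi ν
  | 0, μ, ν, _, _, _ => by
    rw [Measure.pi_of_empty, Measure.pi_of_empty]
  | n + 1, μ, ν, _, _, h => by
    have h₁ := (measurePreserving_piFinSuccAbove μ 0).symm
    have h₂ := (measurePreserving_piFinSuccAbove ν 0).symm
    rw [← h₁.map_eq, ← h₂.map_eq]
    exact ((h 0).prod (pi_absolutelyContinuous fun j => h _)).map (MeasurableEquiv.measurable _)

variable {n : ℕ}

lemma stdGaussian_absolutelyContinuous :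
    stdGaussian (E (Fin n)) ≪ (volume : Measure (E (Fin n))) := by
  rw [← map_pi_eq_stdGaussian, ← (PiLp.volume_preserving_toLp (Fin n)).map_eq]
  exact (pi_absolutelyContinuous fun _ =>
    gaussianReal_absolutelyContinuous 0 one_ne_zero).map (by fun_prop)

lemma absolutelyContinuous_stdGaussian :
    (volume : Measure (E (Fin n))) ≪ stdGaussian (E (Fin n)) := by
  rw [← map_pi_eq_stdGaussian, ← (PiLp.volume_preserving_toLp (Fin n)).map_eq]
  exact (pi_absolutelyContinuous fun _ =>
    gaussianReal_absolutelyContinuous' 0 one_ne_zero).map (by fun_prop)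

lemma volume_preimage_affine_eq_zero_iff {A : Matrix (Fin n) (Fin n) ℝ} (hA : IsUnit A)
    (b : E (Fin n)) (s : Set (E (Fin n))) :
    volume ((fun x => toEuclideanLin A x + b) ⁻¹' s) = 0 ↔ volume s = 0 := by
  have hd : LinearMap.det (toEuclideanLin A) ≠ 0 := by
    have := (Matrix.isUnit_iff_isUnit_det _).1 hA
    rw [toEuclideanLin_eq_toLin_orthonormal, LinearMap.det_toLin]
    exact this.ne_zero
  have e : (fun x => toEuclideanLin A x + b) ⁻¹' s
      = toEuclideanLin A ⁻¹' ((fun x => x + b) ⁻¹' s) := rfl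
  rw [e, Measure.addHaar_preimage_linearMap _ hd, measure_preimage_add_right, mul_eq_zero]
  refine or_iff_right ?_
  rw [ENNReal.ofReal_eq_zero, not_le]
  exact abs_pos.2 (inv_ne_zero hd)

/-- The law is the image of the standard one under an invertible affine map. All nondegenerate
Gaussians thus share the null sets of Lebesgue measure, which lets uniqueness under one law pass to
the others. -/
lemma multivariateGaussian_eq_zero_iff {S : Matrix (Fin n) (Fin n) ℝ} (hS : S.PosDef)
    (μ : E (Fin n)) {s : Set (E (Fin n))} (hs : MeasurableSet s) :
    multivariateGaussian μ S s = 0 ↔ volume s = 0 := by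
  obtain ⟨A, hAS⟩ : ∃ A : Matrix (Fin n) (Fin n) ℝ, A * Aᵀ = S :=
    ⟨_, sqrt_mul_sqrt_transpose hS.posSemidef⟩
  have hA : IsUnit A := isUnit_of_mul_transpose_posDef (hAS ▸ hS)
  have h := map_multivariateGaussian (Matrix.PosSemidef.one (n := Fin n) (R := ℝ)) 0 A μ
  rw [map_zero, zero_add, Matrix.mul_one, hAS, multivariateGaussian_zero_one] at h
  rw [← h, Measure.map_apply ((measurable_toEuclideanLin A).add_const μ) hs,
    ← volume_preimage_affine_eq_zero_iff hA μ s]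
  exact ⟨fun h0 => absolutelyContinuous_stdGaussian h0,
    fun h0 => stdGaussian_absolutelyContinuous h0⟩

lemma ae_multivariateGaussian_eq {S : Matrix (Fin n) (Fin n) ℝ} (hS : S.PosDef)
    (μ : E (Fin n)) : ae (multivariateGaussian μ S) = ae (volume : Measure (E (Fin n))) := by
  refine le_antisymm (Measure.ae_le_iff_absolutelyContinuous.2 ?_)
    (Measure.ae_le_iff_absolutelyContinuous.2 ?_)
  · exact Measure.AbsolutelyContinuous.mk fun s hs h =>
      (multivariateGaussian_eq_zero_iff hS μ hs).2 h
  · exact Measure.AbsolutelyContinuous.mk fun s hs h =>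
      (multivariateGaussian_eq_zero_iff hS μ hs).1 h

end AbsolutelyContinuous

/-! ### Linear regression of `x` on `y` -/

section Regression

variable {n p : ℕ}

/-- The matrix of `z ↦ y`. -/
def obsMat (n p : ℕ) : Matrix (Fin p) (Fin n ⊕ Fin p) ℝ := fromCols 0 1

/-- The matrix of `z ↦ x - G y`. -/
def errMat (G : Matrix (Fin n) (Fin p) ℝ) : Matrix (Fin n) (Fin n ⊕ Fin p) ℝ := fromCols 1 (-G)

/-- The gain `K_{xy} K_y⁻¹`. -/
def regressionGain (K : Matrix (Fin n ⊕ Fin p) (Fin n ⊕ Fin p) ℝ) : Matrix (Fin n) (Fin p) ℝ :=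
  K.toBlocks₁₂ * K.toBlocks₂₂⁻¹

/-- The Schur complement `K_x - K_{xy} K_y⁻¹ K_{yx}`. -/
def schur (K : Matrix (Fin n ⊕ Fin p) (Fin n ⊕ Fin p) ℝ) : Matrix (Fin n) (Fin n) ℝ :=
  K.toBlocks₁₁ - K.toBlocks₁₂ * K.toBlocks₂₂⁻¹ * K.toBlocks₂₁

/-- The covariance which agrees with `K` except in its `x`-block, with Schur complement the
tau-distortion of that of `K`. -/
def distortedCov (τ θ : ℝ) (K : Matrix (Fin n ⊕ Fin p) (Fin n ⊕ Fin p) ℝ) :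
    Matrix (Fin n ⊕ Fin p) (Fin n ⊕ Fin p) ℝ :=
  fromBlocks (distort τ θ (schur K) + K.toBlocks₁₂ * K.toBlocks₂₂⁻¹ * K.toBlocks₂₁)
    K.toBlocks₁₂ K.toBlocks₂₁ K.toBlocks₂₂

/-- The affine estimator `y ↦ m_x + G (y - m_y)`. -/
def affineEstimator (m : E (Fin n ⊕ Fin p)) (G : Matrix (Fin n) (Fin p) ℝ) (y : E (Fin p)) :
    E (Fin n) :=
  xPart m + toEuclideanLin G (y - yPart m)

lemma yPart_eq_obsMat (z : E (Fin n ⊕ Fin p)) : yPart z = toEuclideanLin (obsMat n p) z := by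
  ext j
  simp [yPart, obsMat, toEuclideanLin_eq_toLp, fromCols_mulVec]

lemma measurable_yPart : Measurable (yPart : E (Fin n ⊕ Fin p) → E (Fin p)) := by
  have := measurable_toEuclideanLin (obsMat n p)
  rwa [← funext yPart_eq_obsMat] at this

lemma xPart_sub_eq_errMat (G : Matrix (Fin n) (Fin p) ℝ) (z : E (Fin n ⊕ Fin p)) :
    xPart z - toEuclideanLin G (yPart z) = toEuclideanLin (errMat G) z := by
  ext j
  simp [xPart, yPart, errMat, toEuclideanLin_eq_toLp, fromCols_mulVec, Matrix.neg_mulVec,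
    Function.comp_def, sub_eq_add_neg]

lemma xPart_sub_affineEstimator (m z : E (Fin n ⊕ Fin p)) (G : Matrix (Fin n) (Fin p) ℝ) :
    xPart z - affineEstimator m G (yPart z)
      = toEuclideanLin (errMat G) z + -toEuclideanLin (errMat G) m := by
  rw [← xPart_sub_eq_errMat, ← xPart_sub_eq_errMat, affineEstimator, map_sub]
  abel

lemma posDef_toBlocks₂₂ {K : Matrix (Fin n ⊕ Fin p) (Fin n ⊕ Fin p) ℝ} (hK : K.PosDef) :
    K.toBlocks₂₂.PosDef :=
  hK.submatrix Sum.inr_injective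

lemma obsMat_congr (K : Matrix (Fin n ⊕ Fin p) (Fin n ⊕ Fin p) ℝ) :
    obsMat n p * K * (obsMat n p)ᵀ = K.toBlocks₂₂ := by
  conv_lhs => rw [← fromBlocks_toBlocks K]
  simp [obsMat, transpose_fromCols, fromCols_mul_fromBlocks, fromCols_mul_fromRows]

/-- This is the covariance of `z` with the error `x - G y`. The zero block is the normal equation:
the error is uncorrelated with `y`. -/
lemma mul_errMat_regressionGain {K : Matrix (Fin n ⊕ Fin p) (Fin n ⊕ Fin p) ℝ} (hK : K.PosDef) :
    K * (errMat (regressionGain K))ᵀ = fromRows (schur K) 0 := by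
  have hD := (Matrix.isUnit_iff_isUnit_det _).1 (posDef_toBlocks₂₂ hK).isUnit
  have hKT : Kᵀ = K := hK.1
  have hDT : K.toBlocks₂₂ᵀ = K.toBlocks₂₂ := (posDef_toBlocks₂₂ hK).1
  have hBT : K.toBlocks₁₂ᵀ = K.toBlocks₂₁ := by
    ext i j; exact congrFun (congrFun hKT (Sum.inr i)) (Sum.inl j)
  have hG : (regressionGain K)ᵀ = K.toBlocks₂₂⁻¹ * K.toBlocks₂₁ := by
    rw [regressionGain, Matrix.transpose_mul, Matrix.transpose_nonsing_inv, hDT, hBT]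
  conv_lhs => rw [← fromBlocks_toBlocks K]
  rw [fromBlocks_toBlocks K, errMat, transpose_fromCols, transpose_neg, hG, transpose_one]
  conv_lhs => rw [← fromBlocks_toBlocks K]
  rw [fromBlocks_mul_fromRows, fromBlocks_toBlocks K]
  simp only [Matrix.mul_one, Matrix.mul_neg, ← sub_eq_add_neg, schur]
  rw [Matrix.mul_nonsing_inv_cancel_left _ _ hD, sub_self, Matrix.mul_assoc]

lemma errMat_congr {K : Matrix (Fin n ⊕ Fin p) (Fin n ⊕ Fin p) ℝ} (hK : K.PosDef) :
    errMat (regressionGain K) * K * (errMat (regressionGain K))ᵀ = schur K := by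
  rw [Matrix.mul_assoc, mul_errMat_regressionGain hK, errMat, fromCols_mul_fromRows]
  simp

lemma errMat_mul_obsMat {K : Matrix (Fin n ⊕ Fin p) (Fin n ⊕ Fin p) ℝ} (hK : K.PosDef) :
    errMat (regressionGain K) * K * (obsMat n p)ᵀ = 0 := by
  have h : obsMat n p * (K * (errMat (regressionGain K))ᵀ) = 0 := by
    rw [mul_errMat_regressionGain hK, obsMat, fromCols_mul_fromRows]
    simp
  have h' := congrArg Matrix.transpose h
  rwa [Matrix.transpose_mul, Matrix.transpose_mul, Matrix.transpose_transpose,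
    show Kᵀ = K from hK.1, Matrix.transpose_zero] at h'

lemma posDef_schur {K : Matrix (Fin n ⊕ Fin p) (Fin n ⊕ Fin p) ℝ} (hK : K.PosDef) :
    (schur K).PosDef := by
  rw [← errMat_congr hK]
  -- The identity block of `errMat` makes `v ↦ v * errMat` injective, so compression by it preserves
  -- definiteness.
  refine hK.mul_mul_conjTranspose_same (B := errMat (regressionGain K)) fun v w hvw => ?_
  simp only [errMat, vecMul_fromCols, Matrix.vecMul_one] at hvw
  exact funext fun i => congrFun hvw (Sum.inl i)

/-- The least favorable covariance in terms of a factor of the nominal covariance. -/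
lemma mul_cfc_mul_transpose_eq_distortedCov (τ θ : ℝ)
    {L K : Matrix (Fin n ⊕ Fin p) (Fin n ⊕ Fin p) ℝ} (hK : K.PosDef) (hL : L * Lᵀ = K) :
    L * cfc (distortFun τ θ) ((errMat (regressionGain K) * L)ᵀ * (errMat (regressionGain K) * L))
      * Lᵀ = distortedCov τ θ K := by
  set M := errMat (regressionGain K) with hM
  set N := M * L with hN
  set r : ℝ → ℝ := fun x => (distortFun τ θ x - 1) / x
  have hNN : N * Nᵀ = schur K := by
    rw [hN, Matrix.transpose_mul, Matrix.mul_assoc, ← Matrix.mul_assoc L, hL, ← Matrix.mul_assoc,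
      errMat_congr hK]
  have hLN : L * Nᵀ = fromRows (schur K) 0 := by
    rw [hN, Matrix.transpose_mul, ← Matrix.mul_assoc, hL, mul_errMat_regressionGain hK]
  have hNL : N * Lᵀ = fromCols (schur K) 0 := by
    have h := congrArg Matrix.transpose hLN
    have hs : (schur K)ᵀ = schur K := (posDef_schur hK).1
    rwa [Matrix.transpose_mul, Matrix.transpose_transpose, transpose_fromRows, hs,
      Matrix.transpose_zero] at h
  -- Because `distortFun` is `1` at `0`, what remains after the constant term factors through `N` on
  -- both sides, with `r` evaluated at the Schur complement.
  have hcfc : cfc (distortFun τ θ) (Nᵀ * N) = 1 + Nᵀ * cfc r (schur K) * N := by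
    rw [cfc_eq_smul_one_add_mul _ (isSelfAdjoint_transpose_mul_self N), distortFun_zero, one_smul,
      ← hNN, ← cfc_transpose_mul_self_mul_transpose, Matrix.mul_assoc (cfc r (Nᵀ * N))]
    congr 1
    exact ((Commute.refl (Nᵀ * N)).cfc_real r).eq.symm
  have hV : distort τ θ (schur K) = schur K + schur K * cfc r (schur K) * schur K := by
    rw [distort_eq_cfc_mul _ _ (posDef_schur hK).posSemidef,
      cfc_eq_smul_one_add_mul _ (posDef_schur hK).1, distortFun_zero, one_smul, Matrix.add_mul,
      Matrix.one_mul]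
  calc L * cfc (distortFun τ θ) (Nᵀ * N) * Lᵀ
      = K + (L * Nᵀ) * cfc r (schur K) * (N * Lᵀ) := by
        rw [hcfc, Matrix.mul_add, Matrix.add_mul, Matrix.mul_one, hL]
        simp only [Matrix.mul_assoc]
    _ = K + fromBlocks (schur K * cfc r (schur K) * schur K) 0 0 0 := by
        rw [hLN, hNL, fromRows_mul, fromRows_mul_fromCols]
        simp
    _ = distortedCov τ θ K := by
        conv_lhs => rw [← fromBlocks_toBlocks K]
        rw [fromBlocks_add, fromBlocks_toBlocks K, distortedCov, hV]
        simp only [add_zero]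
        congr 1
        rw [schur]
        abel

end Regression

/-! ### Mean square errors -/

section MeanSquare

variable {n p : ℕ}

lemma integral_affine {ι κ : Type} [Fintype ι] [DecidableEq ι] [Fintype κ] [DecidableEq κ]
    {S : Matrix ι ι ℝ} (hS : S.PosSemidef) (μ : E ι) (A : Matrix κ ι ℝ) (b : E κ) :
    ∫ x, (toEuclideanLin A x + b) ∂(multivariateGaussian μ S) = toEuclideanLin A μ + b := by
  rw [← integral_id_multivariateGaussian (μ := toEuclideanLin A μ + b) (S := A * S * Aᵀ),
    ← map_multivariateGaussian hS, integral_map _ (by fun_prop)]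
  exact ((measurable_toEuclideanLin A).add_const b).aemeasurable

lemma memLp_affineEstimator (m μ : E (Fin n ⊕ Fin p)) (G : Matrix (Fin n) (Fin p) ℝ)
    (S : Matrix (Fin n ⊕ Fin p) (Fin n ⊕ Fin p) ℝ) :
    MemLp (fun z => affineEstimator m G (yPart z)) 2 (multivariateGaussian μ S) := by
  convert memLp_two_affine S μ (G * obsMat n p) (xPart m - toEuclideanLin G (yPart m)) using 2
    with z
  rw [affineEstimator, map_sub, yPart_eq_obsMat z]
  simp only [toEuclideanLin_eq_toLp, Matrix.mulVec_mulVec]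
  abel

lemma measurable_affineEstimator (m : E (Fin n ⊕ Fin p)) (G : Matrix (Fin n) (Fin p) ℝ) :
    Measurable (affineEstimator m G) :=
  ((measurable_toEuclideanLin G).comp (measurable_id.sub_const _)).const_add _

lemma integral_norm_sq_affineEstimator {S : Matrix (Fin n ⊕ Fin p) (Fin n ⊕ Fin p) ℝ}
    (hS : S.PosSemidef) (m μ : E (Fin n ⊕ Fin p)) (G : Matrix (Fin n) (Fin p) ℝ) :
    ∫ z, ‖xPart z - affineEstimator m G (yPart z)‖ ^ 2 ∂(multivariateGaussian μ S)
      = (errMat G *ᵥ (μ - m).ofLp) ⬝ᵥ (errMat G *ᵥ (μ - m).ofLp)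
        + trace (errMat G * S * (errMat G)ᵀ) := by
  simp_rw [xPart_sub_affineEstimator]
  rw [integral_norm_sq_affine hS, ← sub_eq_add_neg, ← map_sub]
  rfl

/-- **Orthogonality principle**: if the error of the affine estimator is uncorrelated with the
observation, it is orthogonal to every square integrable function of the observation. -/
lemma integral_norm_sq_sub {S : Matrix (Fin n ⊕ Fin p) (Fin n ⊕ Fin p) ℝ} (hS : S.PosSemidef)
    (m : E (Fin n ⊕ Fin p)) {G : Matrix (Fin n) (Fin p) ℝ}
    (hG : errMat G * S * (obsMat n p)ᵀ = 0) {g : E (Fin p) → E (Fin n)} (hg : Measurable g)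
    (hg2 : MemLp (fun z => g (yPart z)) 2 (multivariateGaussian m S)) :
    ∫ z, ‖xPart z - g (yPart z)‖ ^ 2 ∂(multivariateGaussian m S)
      = ∫ z, ‖xPart z - affineEstimator m G (yPart z)‖ ^ 2 ∂(multivariateGaussian m S)
        + ∫ z, ‖g (yPart z) - affineEstimator m G (yPart z)‖ ^ 2 ∂(multivariateGaussian m S) := by
  set P := multivariateGaussian m S
  set u : E (Fin n ⊕ Fin p) → E (Fin n) := fun z => xPart z - affineEstimator m G (yPart z) with hu
  set w : E (Fin n ⊕ Fin p) → E (Fin n) := fun z => g (yPart z) - affineEstimator m G (yPart z)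
    with hw
  have hu_eq : u = fun z => toEuclideanLin (errMat G) z + -toEuclideanLin (errMat G) m :=
    funext fun z => xPart_sub_affineEstimator m z G
  have hu2 : MemLp u 2 P := hu_eq ▸ memLp_two_affine S m _ _
  have hw2 : MemLp w 2 P := hg2.sub (memLp_affineEstimator m m G S)
  have hui : ∀ i, MemLp (fun z => u z i) 2 P := fun i =>
    (EuclideanSpace.proj (𝕜 := ℝ) i).comp_memLp' hu2
  have hwi : ∀ i, MemLp (fun z => w z i) 2 P := fun i =>
    (EuclideanSpace.proj (𝕜 := ℝ) i).comp_memLp' hw2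
  -- The error is centred because the estimator is built around the mean `m` of the law itself.
  have hu0 : ∀ i, ∫ z, u z i ∂P = 0 := fun i => by
    have h := (EuclideanSpace.proj (𝕜 := ℝ) i).integral_comp_comm
      (hu2.integrable (by norm_num : (1 : ENNReal) ≤ 2))
    have h0 : ∫ z, u z ∂P = 0 := by
      rw [hu_eq, integral_affine hS, add_neg_cancel]
    rw [h0, map_zero] at h
    exact h
  -- Gaussianity enters here: uncorrelated becomes independent, so the error is independent even of
  -- nonlinear functions of `y`.
  have hind : IndepFun u w P := by
    have h := (indepFun_toEuclideanLin hS m hG).comp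
      (φ := fun e => e + -toEuclideanLin (errMat G) m)
      (ψ := fun y => g y - affineEstimator m G y) (by fun_prop)
      (hg.sub (measurable_affineEstimator m G))
    have hw_eq : w = (fun y => g y - affineEstimator m G y) ∘ toEuclideanLin (obsMat n p) :=
      funext fun z => by simp only [hw, yPart_eq_obsMat, Function.comp]
    rw [hu_eq, hw_eq]
    exact h
  have hcross : ∀ i, ∫ z, u z i * w z i ∂P = 0 := fun i => by
    have hi : IndepFun (fun z => u z i) (fun z => w z i) P :=
      hind.comp (φ := fun e : E (Fin n) => e i) (ψ := fun e : E (Fin n) => e i)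
        (by fun_prop) (by fun_prop)
    have := hi.integral_mul_eq_mul_integral (hui i).1 (hwi i).1
    rw [hu0, zero_mul] at this
    exact this
  have hint : ∀ i, Integrable (fun z => u z i * w z i) P := fun i => (hui i).integrable_mul (hwi i)
  have hexp : ∀ z, ‖xPart z - g (yPart z)‖ ^ 2
      = ‖u z‖ ^ 2 - 2 * (∑ i, u z i * w z i) + ‖w z‖ ^ 2 := fun z => by
    have : xPart z - g (yPart z) = u z - w z := by simp only [hu, hw]; abel
    rw [this, norm_sub_sq_real]
    simp [EuclideanSpace.inner_eq_star_dotProduct, dotProduct, mul_comm]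
  simp_rw [hexp]
  have hsum : Integrable (fun z => 2 * ∑ i, u z i * w z i) P :=
    (integrable_finsetSum _ fun i _ => hint i).const_mul 2
  have hun : Integrable (fun z => ‖u z‖ ^ 2) P := hu2.integrable_norm_pow (by norm_num)
  have hwn : Integrable (fun z => ‖w z‖ ^ 2) P := hw2.integrable_norm_pow (by norm_num)
  have hadd := integral_add (hun.sub hsum) hwn
  simp only [Pi.sub_apply] at hadd
  rw [hadd, integral_sub hun hsum, integral_const_mul, integral_finsetSum _ fun i _ => hint i]
  simp only [hcross, Finset.sum_const_zero, mul_zero, sub_zero]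
  rfl

/-- The `y`-marginal is again a nondegenerate Gaussian, its covariance being a diagonal block of a
positive definite matrix. -/
lemma ae_yPart_iff {S : Matrix (Fin n ⊕ Fin p) (Fin n ⊕ Fin p) ℝ} (hS : S.PosDef)
    (μ : E (Fin n ⊕ Fin p)) {q : E (Fin p) → Prop} (hq : MeasurableSet {y | q y}) :
    (∀ᵐ z ∂(multivariateGaussian μ S), q (yPart z)) ↔ ∀ᵐ y ∂(volume : Measure (E (Fin p))), q y := by
  have h := map_multivariateGaussian hS.posSemidef μ (obsMat n p) 0
  simp only [add_zero, obsMat_congr, ← yPart_eq_obsMat] at h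
  rw [← ae_multivariateGaussian_eq (posDef_toBlocks₂₂ hS) (yPart μ), ← h,
    ae_map_iff measurable_yPart.aemeasurable hq]

end MeanSquare

/-! ### The solution of the penalized minimax problem -/

section MinimaxSolution

variable {n p : ℕ} {τ θ : ℝ} {L K : Matrix (Fin n ⊕ Fin p) (Fin n ⊕ Fin p) ℝ}

lemma errMat_mul_congr (hK : K.PosDef) (hL : L * Lᵀ = K) :
    (errMat (regressionGain K) * L) * (errMat (regressionGain K) * L)ᵀ = schur K := by
  rw [Matrix.transpose_mul, Matrix.mul_assoc, ← Matrix.mul_assoc L, hL, ← Matrix.mul_assoc,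
    errMat_congr hK]

lemma posDef_distortedCov (hθ : 0 < θ) (hK : K.PosDef) (hL : L * Lᵀ = K)
    (h : BelowThreshold τ θ (schur K)) : (distortedCov τ θ K).PosDef := by
  rw [← mul_cfc_mul_transpose_eq_distortedCov τ θ hK hL]
  rw [← errMat_mul_congr hK hL] at h
  exact posDef_congr (posDef_cfc (isSelfAdjoint_transpose_mul_self _) fun s hs =>
    distortFun_pos hθ (belowThresholdScalar_of_mem_spectrum_transpose_mul hθ h s hs))
    (isUnit_of_mul_transpose_posDef (hL ▸ hK))

/-- The distortion leaves `K_{xy}` and `K_y` alone. Hence the estimator that is optimal for the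
nominal law is also optimal for the least favorable one. -/
lemma regressionGain_distortedCov (τ θ : ℝ) (K : Matrix (Fin n ⊕ Fin p) (Fin n ⊕ Fin p) ℝ) :
    regressionGain (distortedCov τ θ K) = regressionGain K := by
  simp [regressionGain, distortedCov]

/-- The affine estimator and the distorted density are in saddle position, and the distorted
density is the only maximizer. -/
lemma penalizedMSE_affineEstimator_le (hτ0 : 0 ≤ τ) (hτ1 : τ ≤ 1) (hθ : 0 < θ) (hK : K.PosDef)
    (hL : L * Lᵀ = K) (h : BelowThreshold τ θ (schur K)) (m : E (Fin n ⊕ Fin p))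
    {f : GaussParam n p} (hf : f ∈ finiteDivSet τ m L) :
    penalizedMSE τ θ m L f (affineEstimator m (regressionGain K))
      ≤ penalizedMSE τ θ m L (m, distortedCov τ θ K) (affineEstimator m (regressionGain K)) ∧
    (penalizedMSE τ θ m L f (affineEstimator m (regressionGain K))
      = penalizedMSE τ θ m L (m, distortedCov τ θ K) (affineEstimator m (regressionGain K)) →
      f = (m, distortedCov τ θ K)) := by
  have hLu : IsUnit L := isUnit_of_mul_transpose_posDef (hL ▸ hK)
  set M := errMat (regressionGain K) with hM
  -- The objective separates into a term in the mean shift and a term in the normalized covariance.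
  have hformula : ∀ f ∈ finiteDivSet τ m L,
      penalizedMSE τ θ m L f (affineEstimator m (regressionGain K))
        = ((M *ᵥ (f.1 - m).ofLp) ⬝ᵥ (M *ᵥ (f.1 - m).ofLp) - θ⁻¹ * meanDiv τ L (f.1 - m))
          + (trace ((M * L)ᵀ * (M * L) * normalizedCov L f.2)
            - θ⁻¹ * trace (cfc (divFun τ) (normalizedCov L f.2))) := fun f hf => by
    have htr : trace (M * f.2 * Mᵀ) = trace ((M * L)ᵀ * (M * L) * normalizedCov L f.2) := by
      conv_lhs => rw [← normalizedCov_congr (K' := f.2) hLu]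
      rw [Matrix.mul_assoc ((M * L)ᵀ), Matrix.trace_mul_comm ((M * L)ᵀ), Matrix.transpose_mul]
      simp only [Matrix.mul_assoc]
    rw [penalizedMSE, GaussParam.law, integral_norm_sq_affineEstimator hf.1.posSemidef,
      tauDiv_toReal hLu hf.1 hf.2, htr]
    ring
  have hf₀ : ((m, distortedCov τ θ K) : GaussParam n p) ∈ finiteDivSet τ m L :=
    ⟨posDef_distortedCov hθ hK hL h, tauDiv_lt_top_iff.2 fun _ => rfl⟩
  have hS₀ : normalizedCov L (distortedCov τ θ K)
      = cfc (distortFun τ θ) ((M * L)ᵀ * (M * L)) := by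
    rw [← mul_cfc_mul_transpose_eq_distortedCov τ θ hK hL, normalizedCov_of_congr hLu]
  have hbelow : BelowThreshold τ θ ((M * L) * (M * L)ᵀ) := by rwa [errMat_mul_congr hK hL]
  obtain ⟨h₁, h₁'⟩ := dotProduct_mulVec_le_meanDiv hτ1 hθ (M := M) hLu hbelow
    (v := f.1 - m) fun h1 => sub_eq_zero.2 (tauDiv_lt_top_iff.1 hf.2 h1)
  obtain ⟨h₂, h₂'⟩ := penalizedTrace_le hτ0 hτ1 hθ hbelow (posDef_normalizedCov hLu hf.1)
  have hzero : (M *ᵥ (m - m).ofLp) ⬝ᵥ (M *ᵥ (m - m).ofLp) - θ⁻¹ * meanDiv τ L (m - m) = 0 := by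
    simp [meanDiv, weightedSq]
  rw [hformula f hf, hformula _ hf₀, hzero, hS₀]
  refine ⟨by linarith, fun he => ?_⟩
  have hm := h₁' (by linarith)
  have hS := h₂' (by linarith)
  refine Prod.ext (sub_eq_zero.1 hm) ?_
  rw [← normalizedCov_congr (K' := f.2) hLu, hS,
    mul_cfc_mul_transpose_eq_distortedCov τ θ hK hL]

/-- Under the distorted density, the excess error of an estimator over the affine one. -/
lemma penalizedMSE_distortedCov (hθ : 0 < θ) (hK : K.PosDef) (hL : L * Lᵀ = K)
    (h : BelowThreshold τ θ (schur K)) (m : E (Fin n ⊕ Fin p)) {g : E (Fin p) → E (Fin n)}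
    (hg : g ∈ estimators τ m L) :
    penalizedMSE τ θ m L (m, distortedCov τ θ K) g
      = penalizedMSE τ θ m L (m, distortedCov τ θ K) (affineEstimator m (regressionGain K))
        + ∫ z, ‖g (yPart z) - affineEstimator m (regressionGain K) (yPart z)‖ ^ 2
          ∂(multivariateGaussian m (distortedCov τ θ K)) := by
  have hpd := posDef_distortedCov hθ hK hL h
  have horth := errMat_mul_obsMat hpd
  rw [regressionGain_distortedCov] at horth
  have hf₀ : ((m, distortedCov τ θ K) : GaussParam n p) ∈ finiteDivSet τ m L :=
    ⟨hpd, tauDiv_lt_top_iff.2 fun _ => rfl⟩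
  rw [penalizedMSE, GaussParam.law,
    integral_norm_sq_sub hpd.posSemidef m horth hg.1 (hg.2 _ hf₀), penalizedMSE]
  ring

lemma le_worstCase {m : E (Fin n ⊕ Fin p)} {f : GaussParam n p} (hf : f ∈ finiteDivSet τ m L)
    (g : E (Fin p) → E (Fin n)) :
    ((penalizedMSE τ θ m L f g : ℝ) : EReal) ≤ worstCase τ θ m L g :=
  le_iSup₂ (f := fun f (_ : f ∈ finiteDivSet τ m L) => ((penalizedMSE τ θ m L f g : ℝ) : EReal))
    f hf

/-- Saddle-point chain: the worst case of the affine estimator is at most its value at the distorted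
law, which is at most the value of any `g` there, hence at most the worst case of `g`. -/
theorem isMinimaxSolution_distortedCov (hτ0 : 0 ≤ τ) (hτ1 : τ ≤ 1) (hθ : 0 < θ) (hK : K.PosDef)
    (hL : L * Lᵀ = K) (h : BelowThreshold τ θ (schur K)) (m : E (Fin n ⊕ Fin p)) :
    IsMinimaxSolution τ θ m L (m, distortedCov τ θ K) (affineEstimator m (regressionGain K)) where
  mem_estimators := ⟨measurable_affineEstimator _ _, fun _ _ => memLp_affineEstimator _ _ _ _⟩
  mem_finiteDivSet := ⟨posDef_distortedCov hθ hK hL h, tauDiv_lt_top_iff.2 fun _ => rfl⟩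
  isMax _ hf := (penalizedMSE_affineEstimator_le hτ0 hτ1 hθ hK hL h m hf).1
  isMin g hg := by
    have hf₀ : ((m, distortedCov τ θ K) : GaussParam n p) ∈ finiteDivSet τ m L :=
      ⟨posDef_distortedCov hθ hK hL h, tauDiv_lt_top_iff.2 fun _ => rfl⟩
    refine (iSup₂_le fun f hf => EReal.coe_le_coe_iff.2
      (penalizedMSE_affineEstimator_le hτ0 hτ1 hθ hK hL h m hf).1).trans
      (le_trans (EReal.coe_le_coe_iff.2 ?_) (le_worstCase hf₀ g))
    rw [penalizedMSE_distortedCov hθ hK hL h m hg]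
    exact le_add_of_nonneg_right (integral_nonneg fun _ => by positivity)

lemma worstCase_eq_of_isMinimaxSolution {m : E (Fin n ⊕ Fin p)} {f : GaussParam n p}
    {g : E (Fin p) → E (Fin n)} (h : IsMinimaxSolution τ θ m L f g) :
    worstCase τ θ m L g = penalizedMSE τ θ m L f g :=
  le_antisymm (iSup₂_le fun f' hf' => EReal.coe_le_coe_iff.2 (h.isMax f' hf'))
    (le_worstCase h.mem_finiteDivSet g)

lemma penalizedMSE_congr_ae {m : E (Fin n ⊕ Fin p)} {f : GaussParam n p}
    (hf : f ∈ finiteDivSet τ m L) {g g' : E (Fin p) → E (Fin n)} (hg : Measurable g)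
    (hg' : Measurable g') (h : g =ᵐ[volume] g') :
    penalizedMSE τ θ m L f g = penalizedMSE τ θ m L f g' := by
  rw [penalizedMSE, penalizedMSE]
  congr 1
  refine integral_congr_ae ?_
  filter_upwards [(ae_yPart_iff hf.1 f.1 (measurableSet_eq_fun hg hg')).2 h] with z hz
  rw [hz]

/-- Solutions share the minimax value, so at the distorted law `g` cannot have positive excess over
the affine estimator. Once the two agree almost everywhere, `f` maximizes the objective of the
affine estimator, whose maximizer is unique. -/
theorem IsMinimaxSolution.eq_distortedCov (hτ0 : 0 ≤ τ) (hτ1 : τ ≤ 1) (hθ : 0 < θ)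
    (hK : K.PosDef) (hL : L * Lᵀ = K) (h : BelowThreshold τ θ (schur K))
    {m : E (Fin n ⊕ Fin p)} {f : GaussParam n p} {g : E (Fin p) → E (Fin n)}
    (hfg : IsMinimaxSolution τ θ m L f g) :
    f = (m, distortedCov τ θ K) ∧ g =ᵐ[volume] affineEstimator m (regressionGain K) := by
  have hsol := isMinimaxSolution_distortedCov hτ0 hτ1 hθ hK hL h m
  set g₀ := affineEstimator m (regressionGain K) with hg₀
  set f₀ : GaussParam n p := (m, distortedCov τ θ K) with hf₀
  have hle : penalizedMSE τ θ m L f₀ g ≤ penalizedMSE τ θ m L f₀ g₀ := by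
    have := hfg.isMin g₀ hsol.mem_estimators
    rw [worstCase_eq_of_isMinimaxSolution hsol, worstCase_eq_of_isMinimaxSolution hfg,
      EReal.coe_le_coe_iff] at this
    exact (hfg.isMax f₀ hsol.mem_finiteDivSet).trans this
  have hexc := penalizedMSE_distortedCov hθ hK hL h m hfg.mem_estimators
  have hg2 : MemLp (fun z => g (yPart z) - g₀ (yPart z)) 2 f₀.law :=
    (hfg.mem_estimators.2 _ hsol.mem_finiteDivSet).sub
      (hsol.mem_estimators.2 _ hsol.mem_finiteDivSet)
  have hint0 : ∫ z, ‖g (yPart z) - g₀ (yPart z)‖ ^ 2 ∂f₀.law = 0 :=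
    le_antisymm (by linarith) (integral_nonneg fun _ => by positivity)
  have hae : g =ᵐ[volume] g₀ := by
    refine (ae_yPart_iff hsol.mem_finiteDivSet.1 m
      (measurableSet_eq_fun hfg.mem_estimators.1 hsol.mem_estimators.1)).1 ?_
    filter_upwards [(integral_eq_zero_iff_of_nonneg (fun _ => by positivity)
      (hg2.integrable_norm_pow (by norm_num))).1 hint0] with z hz
    exact sub_eq_zero.1 (norm_eq_zero.1 (pow_eq_zero_iff two_ne_zero |>.1 hz))
  have hcongr := fun {f'} (hf' : f' ∈ finiteDivSet τ m L) =>
    penalizedMSE_congr_ae (θ := θ) hf' hfg.mem_estimators.1 hsol.mem_estimators.1 hae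
  refine ⟨(penalizedMSE_affineEstimator_le hτ0 hτ1 hθ hK hL h m hfg.mem_finiteDivSet).2 ?_, hae⟩
  refine le_antisymm (hsol.isMax f hfg.mem_finiteDivSet) ?_
  rw [← hcongr hsol.mem_finiteDivSet, ← hcongr hfg.mem_finiteDivSet]
  exact hfg.isMax f₀ hsol.mem_finiteDivSet

end MinimaxSolution

/-! ### The filter -/

namespace StateSpaceModel

variable {n p m : ℕ} (M : StateSpaceModel n p m)

/-- The covariance of `[x_{t+1}ᵀ y_tᵀ]ᵀ` obtained from `V = V_t`. -/
def jointCov (t : ℕ) (V : Matrix (Fin n) (Fin n) ℝ) : Matrix (Fin n ⊕ Fin p) (Fin n ⊕ Fin p) ℝ :=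
  fromRows (M.A t) (M.C t) * V * (fromRows (M.A t) (M.C t))ᵀ + M.noise t * (M.noise t)ᵀ

lemma jointCov_eq_fromBlocks (t : ℕ) (V : Matrix (Fin n) (Fin n) ℝ) :
    M.jointCov t V = fromBlocks (M.A t * V * (M.A t)ᵀ + M.B t * (M.B t)ᵀ)
      (M.A t * V * (M.C t)ᵀ + M.B t * (M.D t)ᵀ) (M.C t * V * (M.A t)ᵀ + M.D t * (M.B t)ᵀ)
      (M.C t * V * (M.C t)ᵀ + M.D t * (M.D t)ᵀ) := by
  simp only [jointCov, noise, transpose_fromRows, fromRows_mul, mul_fromCols,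
    fromCols_fromRows_eq_fromBlocks, fromBlocks_add]

lemma posDef_jointCov {t : ℕ} (hnoise : (M.noise t * (M.noise t)ᵀ).PosDef)
    {V : Matrix (Fin n) (Fin n) ℝ} (hV : V.PosSemidef) : (M.jointCov t V).PosDef :=
  Matrix.PosDef.posSemidef_add (posSemidef_congr hV _) hnoise

lemma gainOf_eq_regressionGain (t : ℕ) (V : Matrix (Fin n) (Fin n) ℝ) :
    M.gainOf t V = regressionGain (M.jointCov t V) := by
  simp [jointCov_eq_fromBlocks, regressionGain, gainOf]

/-- Inserting the gain, one factor `K_y⁻¹` of `G K_y Gᵀ` cancels against `K_y`, which is invertible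
thanks to the noise condition. -/
lemma riccati_eq_schur {t : ℕ} (hnoise : (M.noise t * (M.noise t)ᵀ).PosDef)
    {V : Matrix (Fin n) (Fin n) ℝ} (hV : V.PosSemidef) :
    M.riccati t V = schur (M.jointCov t V) := by
  have hVT : Vᵀ = V := hV.1
  have hD := posDef_toBlocks₂₂ (M.posDef_jointCov hnoise hV)
  have hu := (Matrix.isUnit_iff_isUnit_det _).1 hD.isUnit
  have hDT : (M.C t * V * (M.C t)ᵀ + M.D t * (M.D t)ᵀ)ᵀ
      = M.C t * V * (M.C t)ᵀ + M.D t * (M.D t)ᵀ := by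
    simp [Matrix.transpose_mul, hVT, Matrix.mul_assoc]
  have hBT : (M.A t * V * (M.C t)ᵀ + M.B t * (M.D t)ᵀ)ᵀ
      = M.C t * V * (M.A t)ᵀ + M.D t * (M.B t)ᵀ := by
    simp [Matrix.transpose_mul, hVT, Matrix.mul_assoc]
  rw [jointCov_eq_fromBlocks] at hu ⊢
  simp only [toBlocks_fromBlocks₂₂] at hu
  simp only [riccati, gainOf, schur, toBlocks_fromBlocks₁₁, toBlocks_fromBlocks₁₂,
    toBlocks_fromBlocks₂₁, toBlocks_fromBlocks₂₂]
  rw [Matrix.transpose_mul, Matrix.transpose_nonsing_inv, hDT, hBT,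
    Matrix.nonsing_inv_mul_cancel_right _ _ hu, ← Matrix.mul_assoc]
  abel

/-- Only `V₀` may be singular: the noise makes every later `P` positive definite, and the threshold
passes this on to its distortion. Reaching `V_t` uses the threshold only at steps before `t`. -/
lemma posSemidef_V (hV0 : M.V0.PosSemidef) (hnoise : ∀ t, (M.noise t * (M.noise t)ᵀ).PosDef)
    {τ θ : ℝ} (hθ : 0 < θ) {t : ℕ} (h : ∀ s < t, BelowThreshold τ θ (M.nextP τ θ s)) :
    (M.V τ θ t).PosSemidef := by
  induction t with
  | zero => exact hV0
  | succ t ih =>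
    have hV := ih fun s hs => h s (hs.trans t.lt_succ_self)
    have hP : (M.riccati t (M.V τ θ t)).PosDef := by
      rw [M.riccati_eq_schur (hnoise t) hV]
      exact posDef_schur (M.posDef_jointCov (hnoise t) hV)
    exact (distort_wellDefined hθ hP (h t t.lt_succ_self)).1.posSemidef

lemma pseudoNominalLaw_eq {τ θ : ℝ} {t : ℕ} (hV : (M.V τ θ t).PosSemidef) (x : E (Fin n)) :
    M.pseudoNominalLaw τ θ t x
      = multivariateGaussian (M.nominalMean t x) (M.nominalCov τ θ t) := by
  have hstack : ∀ {k : ℕ} (A : Matrix (Fin n) (Fin k) ℝ) (C : Matrix (Fin p) (Fin k) ℝ)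
      (v : E (Fin k)), toEuclideanLin (fromRows A C) v
        = stack (toEuclideanLin A v) (toEuclideanLin C v) := fun A C v => by
    simp only [toEuclideanLin_eq_toLp, fromRows_mulVec, stack]
  have h := map_prod_stdGaussian hV x (fromRows (M.A t) (M.C t)) (M.noise t)
  rw [hstack] at h
  rw [nominalMean, nominalCov, ← h, pseudoNominalLaw]
  congr 1
  funext w
  rw [hstack, noise, hstack]
  ext (i | i) <;> simp [stack]

lemma update_eq_affineEstimator (τ θ : ℝ) (t : ℕ) (x : E (Fin n)) :
    M.update τ θ t x
      = affineEstimator (M.nominalMean t x) (regressionGain (M.nominalCov τ θ t)) := by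
  funext y
  rw [update, gain, gainOf_eq_regressionGain]
  rfl

end StateSpaceModel

end TauRS

end

open TauRS
theorem mainTheorem4 {n p m : ℕ} (M : StateSpaceModel n p m) (hV0 : M.V0.PosSemidef)
    (hnoise : ∀ t, (M.noise t * (M.noise t)ᵀ).PosDef)
    (τ θ : ℝ) (hτ0 : 0 ≤ τ) (hτ1 : τ ≤ 1) (hθ : 0 < θ) :
    -- the distortion is well defined for `P > 0` below the threshold
    (∀ P : Matrix (Fin n) (Fin n) ℝ, P.PosDef → BelowThreshold τ θ P →
      (distort τ θ P).PosDef ∧ (∃ L, L * Lᵀ = P) ∧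
      ∀ L, L * Lᵀ = P →
        (τ < 1 → (1 - (θ * (1 - τ)) • (Lᵀ * L)).PosDef) ∧
        distort τ θ P = distortFactor τ θ L) ∧
    -- as long as the threshold is respected, the filter runs and solves the minimax problem
    (∀ (y : ℕ → E (Fin p)) (t : ℕ), (∀ s ≤ t, BelowThreshold τ θ (M.nextP τ θ s)) →
      (M.nextP τ θ t).PosDef ∧ (M.V τ θ (t + 1)).PosDef ∧
      M.V τ θ (t + 1) = distort τ θ (M.nextP τ θ t) ∧
      M.xhat τ θ y (t + 1) = M.update τ θ t (M.xhat τ θ y t) (y t) ∧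
      M.pseudoNominalLaw τ θ t (M.xhat τ θ y t)
        = multivariateGaussian (M.nominalMean t (M.xhat τ θ y t)) (M.nominalCov τ θ t) ∧
      (M.nominalCov τ θ t).PosDef ∧
      M.nextP τ θ t = (M.nominalCov τ θ t).toBlocks₁₁ - (M.nominalCov τ θ t).toBlocks₁₂
        * (M.nominalCov τ θ t).toBlocks₂₂⁻¹ * (M.nominalCov τ θ t).toBlocks₂₁ ∧
      ∀ L, L * Lᵀ = M.nominalCov τ θ t →
        IsMinimaxSolution τ θ (M.nominalMean t (M.xhat τ θ y t)) L
          (M.nominalMean t (M.xhat τ θ y t), M.leastFavorableCov τ θ t)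
          (M.update τ θ t (M.xhat τ θ y t)) ∧
        ∀ f g, IsMinimaxSolution τ θ (M.nominalMean t (M.xhat τ θ y t)) L f g →
          f = (M.nominalMean t (M.xhat τ θ y t), M.leastFavorableCov τ θ t) ∧
          g =ᵐ[volume] M.update τ θ t (M.xhat τ θ y t)) := by
  refine ⟨fun P hP h => distort_wellDefined hθ hP h, fun y t h => ?_⟩
  have hV : (M.V τ θ t).PosSemidef := M.posSemidef_V hV0 hnoise hθ fun s hs => h s hs.le
  have hK : (M.nominalCov τ θ t).PosDef := M.posDef_jointCov (hnoise t) hV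
  have hP : M.nextP τ θ t = schur (M.nominalCov τ θ t) := M.riccati_eq_schur (hnoise t) hV
  have hPpos : (M.nextP τ θ t).PosDef := hP ▸ posDef_schur hK
  have hbelow : BelowThreshold τ θ (schur (M.nominalCov τ θ t)) := hP ▸ h t le_rfl
  have hcov : M.leastFavorableCov τ θ t = distortedCov τ θ (M.nominalCov τ θ t) := by
    rw [distortedCov, ← hP]
    rfl
  refine ⟨hPpos, (distort_wellDefined hθ hPpos (h t le_rfl)).1, rfl, rfl,
    M.pseudoNominalLaw_eq hV _, hK, hP, fun L hL => ?_⟩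
  rw [hcov, M.update_eq_affineEstimator]
  exact ⟨isMinimaxSolution_distortedCov hτ0 hτ1 hθ hK hL hbelow _,
    fun f g hfg => hfg.eq_distortedCov hτ0 hτ1 hθ hK hL hbelow⟩
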